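/- Let $n\ge 2$, $p>n-1$, $\alpha=\frac{p}{p-n+1}$, let $D\subset\mathbb R^n$ be a domain (non-empty, open, connected) and let $f:D\to\mathbb R^n$ be a continuous mapping that is differentiable almost everywhere and has both Luzin properties with respect to Lebesgue measure $m$: $m(A)=0$ implies $m(f(A))=0$ for $A\subset D$ ($N$-property), and $m(A)=0$ implies $m(f^{-1}(A))=0$ for $A\subset\mathbb R^n$ ($N^{-1}$-property). Let $y_0\in\overline{f(D)}$ be a (finite) point of $\mathbb R^n$, let $r_0=\sup_{y\in f(D)}|y-y_0|\in[0,\infty]$, and fix $\varepsilon>0$. Write $S(y_0,r)=\{y:|y-y_0|=r\}$ and $A(y_0,\varepsilon,r_0)=\{y:\varepsilon<|y-y_0|<r_0\}$, and let $\mathcal H^{n-1}$ be the $(n-1)$-dimensional Hausdorff measure. Suppose that for almost all $r\in(\varepsilon,r_0)$ the mapping $f$ has the $N^{-1}$-property on $S(y_0,r)\cap f(D)$ with respect to $\mathcal H^{n-1}$: if $A\subset S(y_0,r)\cap f(D)$ and $\mathcal H^{n-1}(A)=0$, then $\mathcal H^{n-1}(f^{-1}(A))=0$. Let $\Sigma_\varepsilon$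 be the family of all sets $f^{-1}(S(y_0,r)\cap f(D))$, $r\in(\varepsilon,r_0)$, and let $f(\Sigma_\varepsilon)$ be the family of their images $S(y_0,r)\cap f(D)$. Let $N(f,D)=\sup_{y}\operatorname{card}\{x\in D:f(x)=y\}$, and $$Q(y)=\sum_{x\in D,\ f(x)=y}K_{O,\alpha}(x,f),\qquad K_{O,\alpha}(x,f)=\begin{cases}\|f'(x)\|^{\alpha}/|\det f'(x)|,&\det f'(x)\ne0,\\ 1,&f'(x)=0,\\ \infty,&\text{otherwise,}\end{cases}$$ which is defined for all $y$ outside the image of the set of points of non-differentiability of $f$, hence for almost every $y$. Then $$\widetilde M_{\frac{p}{n-1}}(\Sigma_\varepsilon)\ \ge\ \frac{1}{N(f,D)^{\frac{p}{n-1}}}\ \inf_{\rho}\ \int_{f(D)\cap A(y_0,\varepsilon,r_0)}\frac{\rho^p(y)}{Q^{\frac{p-n+1}{n-1}}(y)}\,dm(y),$$ where the conventions $1/\infty=0$ and $0\cdot\infty=0$ are used (so that the right-hand side is $0$ if $N(f,D)=\infty$), and where: * $\widetilde M_q(\Sigma)=\inf\int_{\mathbb R^n}\rho^q\,dm$ over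 all Borel functions $\rho:\mathbb R^n\to[0,\infty]$ with $\int_\sigma\rho\,d\mathcal H^{n-1}\ge1$ for every $\sigma\in\Sigma$ (and $\inf\varnothing=\infty$); * the infimum on the right is over all $\rho$ that are $p$-extensively admissible for $f(\Sigma_\varepsilon)$, that is, over all Lebesgue measurable $\rho:\mathbb R^n\to[0,\infty]$ such that $\int_S\rho^{n-1}\,d\mathcal H^{n-1}\ge1$ for all $S\in f(\Sigma_\varepsilon)$ outside a subfamily $\Gamma_0$ with $M_p(\Gamma_0)=0$; here $M_p(\Gamma)=\inf\int_{\mathbb R^n}\rho^p\,dm$ over all Borel $\rho:\mathbb R^n\to[0,\infty]$ with $\int_S\rho^{n-1}\,d\mathcal H^{n-1}\ge1$ for every $S\in\Gamma$. -/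

import Mathlib

open MeasureTheory Set
open scoped ENNReal

noncomputable section

namespace PoletskyInverse

/-- Euclidean `n`-space. -/
abbrev E (n : ℕ) := EuclideanSpace ℝ (Fin n)

/-- The `(n-1)`-dimensional Hausdorff measure on Euclidean `n`-space. -/
def areaMeasure (n : ℕ) : Measure (E n) := Measure.hausdorffMeasure ((n : ℝ) - 1)

/-- `f : D → ℝⁿ` has the Luzin `N`-property with respect to Lebesgue measure. -/
def LuzinN {n : ℕ} (f : E n → E n) (D : Set (E n)) : Prop :=
  ∀ A ⊆ D, volume A = 0 → volume (f '' A) = 0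

/-- `f : D → ℝⁿ` has the Luzin `N⁻¹`-property with respect to Lebesgue measure. -/
def LuzinNInv {n : ℕ} (f : E n → E n) (D : Set (E n)) : Prop :=
  ∀ A : Set (E n), volume A = 0 → volume (D ∩ f ⁻¹' A) = 0

/-- `f : D → ℝⁿ` has the `N⁻¹`-property on the set `S` with respect to `(n-1)`-dimensional
Hausdorff measure. -/
def LuzinNInvOn {n : ℕ} (f : E n → E n) (D S : Set (E n)) : Prop :=
  ∀ A ⊆ S, areaMeasure n A = 0 → areaMeasure n (D ∩ f ⁻¹' A) = 0

/-- The Jacobian `J(x, f) = det f'(x)`. -/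
def jacobian {n : ℕ} (f : E n → E n) (x : E n) : ℝ := (fderiv ℝ f x).det

open Classical in
/-- The outer dilatation `K_{O,α}(x, f)` of order `α` at a point of differentiability `x`. -/
def outerDilatation {n : ℕ} (α : ℝ) (f : E n → E n) (x : E n) : ℝ≥0∞ :=
  if jacobian f x ≠ 0 then ENNReal.ofReal (‖fderiv ℝ f x‖ ^ α / |jacobian f x|)
  else if fderiv ℝ f x = 0 then 1
  else ⊤

/-- The multiplicity function `N(y, f, A)`. -/
def multiplicityAt {n : ℕ} (f : E n → E n) (A : Set (E n)) (y : E n) : ℕ∞ :=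
  Set.encard {x | x ∈ A ∧ f x = y}

/-- The maximal multiplicity `N(f, A) = sup_y N(y, f, A)`. -/
def maxMultiplicity {n : ℕ} (f : E n → E n) (A : Set (E n)) : ℕ∞ :=
  ⨆ y : E n, multiplicityAt f A y

/-- `Q(y) = K_{I,α}(y, f⁻¹) = ∑_{x ∈ f⁻¹(y)} K_{O,α}(x, f)`. It is meaningful for `y` outside the
image of the set of points of non-differentiability of `f`. That image is a Lebesgue null set
when `f` is differentiable almost everywhere and has the `N`-property, so the values of `Q` there
do not influence Lebesgue integrals. -/
def inverseDilatation {n : ℕ} (α : ℝ) (f : E n → E n) (D : Set (E n)) (y : E n) : ℝ≥0∞ :=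
  ∑' x : {x : E n // x ∈ D ∧ f x = y}, outerDilatation α f x

/-- `r₀ = sup_{y ∈ f(D)} |y - y₀|`, possibly infinite. -/
def outerRadius {n : ℕ} (f : E n → E n) (D : Set (E n)) (y₀ : E n) : ℝ≥0∞ :=
  ⨆ y ∈ f '' D, edist y y₀

/-- The radii `r ∈ (ε, R)`, where `R ≤ ∞`. -/
def radii (ε : ℝ) (R : ℝ≥0∞) : Set ℝ := {r | ε < r ∧ ENNReal.ofReal r < R}

/-- The spherical ring `A(y₀, ε, R)`, where `R ≤ ∞`. -/
def sphericalRing {n : ℕ} (y₀ : E n) (ε : ℝ) (R : ℝ≥0∞) : Set (E n) :=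
  {y | ε < dist y y₀ ∧ edist y y₀ < R}

/-- The family `Σ_ε` of all sets `f⁻¹(S(y₀, r) ∩ f(D))`, `r ∈ (ε, r₀)`. -/
def preimageSpheres {n : ℕ} (f : E n → E n) (D : Set (E n)) (y₀ : E n) (ε : ℝ) :
    Set (Set (E n)) :=
  {σ | ∃ r ∈ radii ε (outerRadius f D y₀), σ = D ∩ f ⁻¹' (Metric.sphere y₀ r ∩ f '' D)}

/-- The family `f(Σ)` of the images of the members of a family `Σ` of sets. -/
def imageFamily {n : ℕ} (f : E n → E n) (F : Set (Set (E n))) : Set (Set (E n)) :=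
  (fun σ => f '' σ) '' F

/-- Admissible functions in the definition of the modulus of a family of separating sets:
Borel functions `ρ ≥ 0` with `∫_σ ρ dℋⁿ⁻¹ ≥ 1` for all `σ` in the family. -/
def admTilde {n : ℕ} (F : Set (Set (E n))) : Set (E n → ℝ≥0∞) :=
  {ρ | Measurable ρ ∧ ∀ σ ∈ F, 1 ≤ ∫⁻ x in σ, ρ x ∂(areaMeasure n)}

/-- The modulus of order `q` of a family of separating sets. -/
def modulusTilde {n : ℕ} (q : ℝ) (F : Set (Set (E n))) : ℝ≥0∞ :=
  ⨅ ρ ∈ admTilde F, ∫⁻ x, ρ x ^ q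

/-- `∫_S ρⁿ⁻¹ d𝒜` for a surface `S` given as a set covered with multiplicity one. -/
def surfaceIntegral {n : ℕ} (ρ : E n → ℝ≥0∞) (S : Set (E n)) : ℝ≥0∞ :=
  ∫⁻ y in S, ρ y ^ ((n : ℝ) - 1) ∂(areaMeasure n)

/-- Borel functions admissible for a family of surfaces. -/
def adm {n : ℕ} (F : Set (Set (E n))) : Set (E n → ℝ≥0∞) :=
  {ρ | Measurable ρ ∧ ∀ S ∈ F, 1 ≤ surfaceIntegral ρ S}

/-- The `p`-modulus of a family of surfaces. -/
def modulus {n : ℕ} (p : ℝ) (F : Set (Set (E n))) : ℝ≥0∞ :=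
  ⨅ ρ ∈ adm F, ∫⁻ y, ρ y ^ p

/-- The property `P` holds for `p`-almost all surfaces of the family `F`. -/
def AlmostAllSurfaces {n : ℕ} (p : ℝ) (F : Set (Set (E n))) (P : Set (E n) → Prop) : Prop :=
  ∃ F₀ ⊆ F, modulus p F₀ = 0 ∧ ∀ S ∈ F \ F₀, P S

/-- Lebesgue measurable functions that are `p`-extensively admissible for a family of surfaces. -/
def extAdm {n : ℕ} (p : ℝ) (F : Set (Set (E n))) : Set (E n → ℝ≥0∞) :=
  {ρ | NullMeasurable ρ volume ∧ AlmostAllSurfaces p F (fun S => 1 ≤ surfaceIntegral ρ S)}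

end PoletskyInverse

end

open PoletskyInverse

open PoletskyInverse

section

open Filter Topology NNReal

/-! Put m = n - 1. Up to a null set, D splits into pieces B_k on which f is injective and almost
linear. A linear automorphism T satisfies: T⁻¹ enlarges m-dimensional area in a hyperplane by at
most ‖T‖/|det T|. Small pieces of spheres are almost flat, so on B_k the area of preimages of
spheres is controlled by a constant c_k close to ‖f'‖/|J|. Given g admissible for the preimages, ρ =
(∑ c_k g ∘ (f|B_k)⁻¹)^(1/m) therefore satisfies ∫_S ρ^m ≥ ∫_{f⁻¹(S)} g ≥ 1 on almost every sphere.
The exponents p/m and α are conjugate, so Hölder's inequality over the fibre bounds ρ^p /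
Q^((p-m)/m) by the sum of g^(p/m)/|J|, up to a factor tending to 1, and a change of variables
finishes the estimate.

The part Z of D outside the pieces is harmless: the N-property makes f(Z) null, almost every sphere
meets f(Z) in zero area, and the N⁻¹-property on spheres pulls this back to D.

The remaining null set of radii must give a family of zero p-modulus. The density equal to ∞ on
those spheres shows this once every S(y₀, r) ∩ f(D) has positive area, and this is the topological
core (`areaMeasure_sphere_inter_image_ne_zero`). A set separating two faces of a cube cannot be sent
onto an area-null set by a finite-to-one continuous map: otherwise the projection to ℝᵐ could be
approximated on the separator by maps with null image, against the Poincaré–Miranda theorem. Finite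
multiplicity supplies the finite fibres. If N(f, D) = ∞ there is nothing to prove; otherwise the
factor on the left is at most 1. -/

theorem Polynomial.eval_eq_sum_lagrange_basis (d : ℕ) (P : Polynomial ℝ) (hP : P.natDegree ≤ d)
    (v : ℕ → ℝ) (hv : Function.Injective v) (t : ℝ) :
    P.eval t = ∑ i ∈ Finset.range (d + 1),
      P.eval (v i) * (Lagrange.basis (Finset.range (d + 1)) v i).eval t := by
  have h := Lagrange.eq_interpolate (f := P) (s := Finset.range (d + 1)) (v := v)
    hv.injOn (by
      refine lt_of_le_of_lt Polynomial.degree_le_natDegree ?_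
      rw [Finset.card_range]; exact_mod_cast Nat.lt_succ_of_le hP)
  conv_lhs => rw [h, Lagrange.interpolate_apply]
  simp [Polynomial.eval_finsetSum]

/-! ### Zeros of compactly supported perturbations of the identity -/

section BrouwerDegree

variable {n : ℕ}

/-- A kernel vector of id + sA with 0 ≤ s ≤ 1 would satisfy ‖v‖ ≤ ‖A‖‖v‖, so the determinant keeps
the sign it has at s = 0. -/
theorem ContinuousLinearMap.det_one_add_pos {E : Type*} [NormedAddCommGroup E] [NormedSpace ℝ E]
    [FiniteDimensional ℝ E] (A : E →L[ℝ] E) (hA : ‖A‖ < 1) :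
    0 < (ContinuousLinearMap.id ℝ E + A).det := by
  have hne : ∀ s ∈ Icc (0 : ℝ) 1, (ContinuousLinearMap.id ℝ E + s • A).det ≠ 0 := by
    intro s hs h0
    obtain ⟨v, hv, hv0⟩ := (Submodule.ne_bot_iff _).1
      (LinearMap.bot_lt_ker_of_det_eq_zero
        (f := ((ContinuousLinearMap.id ℝ E + s • A : E →L[ℝ] E) : E →ₗ[ℝ] E)) h0).ne'
    have hv1 : v + s • A v = 0 := by simpa using hv
    have hv2 : ‖v‖ = ‖s • A v‖ := by
      conv_lhs => rw [eq_neg_of_add_eq_zero_left hv1, norm_neg]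
    have hv3 : ‖s • A v‖ ≤ ‖A‖ * ‖v‖ := by
      rw [norm_smul, Real.norm_of_nonneg hs.1]
      calc s * ‖A v‖ ≤ 1 * ‖A v‖ := by gcongr; exact hs.2
        _ ≤ _ := by rw [one_mul]; exact A.le_opNorm v
    have : 0 < ‖v‖ := norm_pos_iff.2 hv0
    nlinarith
  by_contra hneg
  push Not at hneg
  have hc : ContinuousOn (fun s : ℝ => (ContinuousLinearMap.id ℝ E + s • A).det) (Icc 0 1) := by
    apply Continuous.continuousOn
    exact ContinuousLinearMap.continuous_det.comp (by fun_prop)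
  have := intermediate_value_Icc' zero_le_one hc
  obtain ⟨s, hs, hs0⟩ := this (show (0 : ℝ) ∈ Icc _ _ by
    refine ⟨by simpa using hneg, ?_⟩
    have : (ContinuousLinearMap.id ℝ E + (0 : ℝ) • A) = ContinuousLinearMap.id ℝ E := by simp
    simp only [this]
    simp [ContinuousLinearMap.det])
  exact hne s hs hs0

theorem ContDiff.hasFDerivAt_id_add_smul {E : Type*} [NormedAddCommGroup E] [NormedSpace ℝ E]
    {h : E → E} (hh : ContDiff ℝ 1 h) (t : ℝ) (x : E) :
    HasFDerivAt (fun x => x + t • h x) (ContinuousLinearMap.id ℝ E + t • fderiv ℝ h x) x :=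
  (hasFDerivAt_id x).add (((hh.differentiable one_ne_zero) x).hasFDerivAt.const_smul t)

/-- For small t the map x + t h(x) is a contractive perturbation of the identity, hence a bijection.
It is the identity off the ball, so it maps the ball onto itself, and its Jacobian is positive. The
claim is then the change of variables formula. -/
theorem exists_setIntegral_comp_id_add_smul_mul_det {E : Type*} [NormedAddCommGroup E]
    [NormedSpace ℝ E] [FiniteDimensional ℝ E] [MeasurableSpace E] [BorelSpace E] (μ : Measure E)
    [μ.IsAddHaarMeasure] {h : E → E}
    (hh : ContDiff ℝ 1 h) (hc : HasCompactSupport h) :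
    ∃ τ > 0, ∀ t : ℝ, |t| < τ → ∀ R : ℝ, (∀ x, R < ‖x‖ → h x = 0) → ∀ w : E → ℝ,
      ∫ x in Metric.closedBall (0 : E) R, w (x + t • h x) *
        (ContinuousLinearMap.id ℝ E + t • fderiv ℝ h x).det ∂μ =
      ∫ x in Metric.closedBall (0 : E) R, w x ∂μ := by
  obtain ⟨K, hK⟩ := hh.lipschitzWith_of_hasCompactSupport hc one_ne_zero
  refine ⟨1 / (K + 1), by positivity, fun t ht R hR w => ?_⟩
  have htK : |t| * K < 1 := by
    rw [lt_div_iff₀ (by positivity)] at ht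
    nlinarith [abs_nonneg t]
  set F : E → E := fun x => x + t • h x with hF
  have happ : ApproximatesLinearOn F
      ((ContinuousLinearEquiv.refl ℝ E : E ≃L[ℝ] E) : E →L[ℝ] E) univ (‖t‖₊ * K) := by
    intro x _ y _
    have : F x - F y - ((ContinuousLinearEquiv.refl ℝ E : E ≃L[ℝ] E) : E →L[ℝ] E) (x - y) =
        t • (h x - h y) := by
      simp [hF, smul_sub]; abel
    rw [this, norm_smul]
    have := hK.dist_le_mul x y
    rw [dist_eq_norm, dist_eq_norm] at this
    push_cast
    rw [mul_assoc]
    gcongr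
  have hcond : Subsingleton E ∨ ‖t‖₊ * K <
      ‖(((ContinuousLinearEquiv.refl ℝ E).symm : E ≃L[ℝ] E) : E →L[ℝ] E)‖₊⁻¹ := by
    rcases subsingleton_or_nontrivial E with hs | hs
    · exact Or.inl hs
    · right
      have : (((ContinuousLinearEquiv.refl ℝ E).symm : E ≃L[ℝ] E) : E →L[ℝ] E) =
        ContinuousLinearMap.id ℝ E := rfl
      rw [this, ← NNReal.coe_lt_coe]
      simpa using htK
  have hinj : Function.Injective F := by
    intro x y hxy
    exact happ.injOn hcond (mem_univ x) (mem_univ y) hxy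
  have hsurj : Function.Surjective F := happ.surjective hcond
  have hout : ∀ x, R < ‖x‖ → F x = x := fun x hx => by simp [hF, hR x hx]
  have himg : F '' Metric.closedBall 0 R = Metric.closedBall 0 R := by
    ext y
    simp only [mem_image, mem_closedBall_zero_iff]
    constructor
    · rintro ⟨x, hx, rfl⟩
      by_contra hy
      push Not at hy
      have := hinj (hout _ hy)
      rw [this] at hy
      exact absurd hx (not_le.2 hy)
    · intro hy
      obtain ⟨x, rfl⟩ := hsurj y
      refine ⟨x, ?_, rfl⟩
      by_contra hx
      push Not at hx
      rw [hout x hx] at hy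
      exact absurd hy (not_le.2 hx)
  have hcv := integral_image_eq_integral_abs_det_fderiv_smul μ
    (measurableSet_closedBall (x := (0 : E)) (ε := R))
    (fun x _ => (hh.hasFDerivAt_id_add_smul t x).hasFDerivWithinAt) hinj.injOn w
  change ∫ x in F '' Metric.closedBall 0 R, w x ∂μ = _ at hcv
  rw [himg] at hcv
  rw [hcv]
  refine setIntegral_congr_fun measurableSet_closedBall fun x _ => ?_
  have hpos : 0 < (ContinuousLinearMap.id ℝ E + t • fderiv ℝ h x).det := by
    apply ContinuousLinearMap.det_one_add_pos
    rw [norm_smul]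
    refine lt_of_le_of_lt ?_ htK
    gcongr
    · rfl
    · exact norm_fderiv_le_of_lipschitz ℝ hK
  simp only [abs_of_pos hpos, smul_eq_mul]
  ring

/-- The degree bound does not depend on x, so one set of interpolation nodes serves for all x and
interpolation commutes with integration in x. -/
theorem exists_polynomial_eval_eq_mul_det (x v : EuclideanSpace ℝ (Fin n))
    (A : EuclideanSpace ℝ (Fin n) →L[ℝ] EuclideanSpace ℝ (Fin n)) (M : ℝ) (k : ℕ) :
    ∃ P : Polynomial ℝ, P.natDegree ≤ 2 * k + n ∧ ∀ t : ℝ, P.eval t =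
      (1 - ‖x + t • v‖ ^ 2 / M ^ 2) ^ k * (ContinuousLinearMap.id ℝ _ + t • A).det := by
  classical
  let b := (EuclideanSpace.basisFun (Fin n) ℝ).toBasis
  let AM : Matrix (Fin n) (Fin n) ℝ := LinearMap.toMatrix b b (A : _ →ₗ[ℝ] _)
  let D : Polynomial ℝ := ((Polynomial.X : Polynomial ℝ) • AM.map Polynomial.C
    + (1 : Matrix (Fin n) (Fin n) ℝ).map Polynomial.C).det
  let q : Polynomial ℝ := Polynomial.C (1 - ‖x‖ ^ 2 / M ^ 2) +
    Polynomial.C (-(2 * inner ℝ x v / M ^ 2)) * Polynomial.X +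
    Polynomial.C (-(‖v‖ ^ 2 / M ^ 2)) * Polynomial.X ^ 2
  refine ⟨q ^ k * D, ?_, fun t => ?_⟩
  · refine Polynomial.natDegree_mul_le.trans (add_le_add ?_ ?_)
    · refine Polynomial.natDegree_pow_le.trans ?_
      rw [mul_comm]
      gcongr
      simp only [q]
      compute_degree
    · simpa only [Fintype.card_fin] using Polynomial.natDegree_det_X_add_C_le AM 1
  · rw [Polynomial.eval_mul, Polynomial.eval_pow]
    congr 2
    · simp only [q, Polynomial.eval_add, Polynomial.eval_mul, Polynomial.eval_C, Polynomial.eval_X,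
        Polynomial.eval_pow]
      rw [norm_add_sq_real, inner_smul_right, norm_smul, mul_pow]
      simp only [Real.norm_eq_abs, sq_abs]
      ring
    · have h1 : (ContinuousLinearMap.id ℝ (EuclideanSpace ℝ (Fin n)) + t • A).det =
          (1 + t • AM).det := by
        rw [ContinuousLinearMap.det, ← LinearMap.det_toMatrix b]
        congr 1
        simp [AM]
      rw [h1]
      simp only [D]
      rw [← Polynomial.coe_evalRingHom, RingHom.map_det]
      congr 1
      ext i j
      simp [Matrix.one_apply, Polynomial.coe_evalRingHom]
      split_ifs <;> simp <;> ring

/-- The integral of w(x + t h(x)) J_t(x) is polynomial in t for the weights used and constant for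
small t, hence the same at t = 1. If x + h(x) stayed away from 0, powers of a weight peaked at 0
would make the value at t = 1 decay faster than the value at t = 0. -/
theorem ContDiff.exists_add_eq_zero_of_hasCompactSupport
    {h : E n → E n}
    (hh : ContDiff ℝ 1 h) (hc : HasCompactSupport h) : ∃ x, x + h x = 0 := by
  by_contra hne
  push Not at hne
  obtain ⟨R₀, hR₀⟩ := hc.isCompact.isBounded.subset_closedBall (0 : E n)
  set R := max R₀ 1 with hRdef
  have hR1 : 1 ≤ R := le_max_right _ _
  have hR : ∀ x : E n, R < ‖x‖ → h x = 0 := by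
    intro x hx
    by_contra h0
    have := hR₀ (subset_tsupport h h0)
    rw [mem_closedBall_zero_iff] at this
    exact absurd (this.trans (le_max_left _ 1)) (not_le.2 hx)
  set B := Metric.closedBall (0 : E n) R with hB
  have hBc : IsCompact B := isCompact_closedBall _ _
  have hBne : B.Nonempty := ⟨0, by simp [hB]; linarith⟩
  have hFc : Continuous fun x : E n => x + h x := continuous_id.add hh.continuous
  obtain ⟨x₀, hx₀, hmin⟩ := hBc.exists_isMinOn hBne hFc.norm.continuousOn
  obtain ⟨x₁, hx₁, hmax⟩ := hBc.exists_isMaxOn hBne hFc.norm.continuousOn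
  obtain ⟨δ, hδ0, hδR, hδ⟩ : ∃ δ > 0, δ ≤ R ∧ ∀ x ∈ B, δ ≤ ‖x + h x‖ :=
    ⟨min ‖x₀ + h x₀‖ R, lt_min (norm_pos_iff.2 (hne x₀)) (by linarith), min_le_right _ _,
      fun x hx => (min_le_left _ _).trans (hmin hx)⟩
  -- M bounds both the ball and its image, so the weight 1 - ‖y‖²/M² is nonnegative on both.
  obtain ⟨M, hMR, hM⟩ : ∃ M ≥ R, ∀ x ∈ B, ‖x + h x‖ ≤ M :=
    ⟨max ‖x₁ + h x₁‖ R, le_max_right _ _, fun x hx => (hmax hx).trans (le_max_left _ _)⟩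
  have hM0 : 0 < M := by linarith
  let J : ℝ → E n → ℝ := fun t x => (ContinuousLinearMap.id ℝ (E n) + t • fderiv ℝ h x).det
  have hJc : ∀ t, Continuous (J t) := fun t =>
    ContinuousLinearMap.continuous_det.comp
      (continuous_const.add ((hh.continuous_fderiv one_ne_zero).const_smul t))
  obtain ⟨C, hC⟩ := hBc.exists_bound_of_continuousOn (hJc 1).continuousOn
  obtain ⟨τ, hτ, hinv⟩ := exists_setIntegral_comp_id_add_smul_mul_det
    (volume : Measure (E n)) hh hc
  let w : ℕ → E n → ℝ := fun k y => (1 - ‖y‖ ^ 2 / M ^ 2) ^ k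
  have hwc : ∀ k, Continuous (w k) := fun k => by fun_prop
  have hcont : ∀ k t, Continuous fun x => w k (x + t • h x) * J t x := fun k t =>
    ((hwc k).comp (continuous_id.add (hh.continuous.const_smul t))).mul (hJc t)
  have hkey : ∀ k, ∫ x in B, w k (x + (1 : ℝ) • h x) * J 1 x = ∫ x in B, w k x := by
    intro k
    set d := 2 * k + n
    -- Distinct nodes in (0, τ), where the integral is already known to be constant.
    let v : ℕ → ℝ := fun i => τ / (i + 2)
    have hv : Function.Injective v := by
      intro i j hij
      simp only [v] at hij
      rw [div_eq_div_iff (by positivity) (by positivity)] at hij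
      have := mul_left_cancel₀ hτ.ne' hij
      have : (j : ℝ) = i := by linarith
      exact_mod_cast this.symm
    have hvτ : ∀ i, |v i| < τ := by
      intro i
      simp only [v]
      rw [abs_of_pos (by positivity), div_lt_iff₀ (by positivity)]
      nlinarith [(Nat.cast_nonneg i : (0 : ℝ) ≤ i)]
    have hpt : ∀ x, w k (x + (1 : ℝ) • h x) * J 1 x = ∑ i ∈ Finset.range (d + 1),
        (w k (x + v i • h x) * J (v i) x) *
          (Lagrange.basis (Finset.range (d + 1)) v i).eval 1 := by
      intro x
      obtain ⟨P, hPd, hP⟩ := exists_polynomial_eval_eq_mul_det x (h x) (fderiv ℝ h x) M k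
      have := P.eval_eq_sum_lagrange_basis d hPd v hv 1
      simpa only [hP] using this
    simp_rw [hpt]
    rw [integral_finsetSum]
    · simp_rw [integral_mul_const]
      have : ∀ i, ∫ x in B, w k (x + v i • h x) * J (v i) x = ∫ x in B, w k x :=
        fun i => hinv (v i) (hvτ i) R hR (w k)
      simp_rw [this, ← Finset.mul_sum]
      rw [← Polynomial.eval_finsetSum, Lagrange.sum_basis hv.injOn ⟨0, by simp⟩]
      simp
    · intro i _
      exact ((hcont k (v i)).mul continuous_const).continuousOn.integrableOn_compact hBc
  -- The weight is at most a at the points x + h(x) and at least b on the ball of radius δ/2.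
  set a := 1 - δ ^ 2 / M ^ 2 with ha
  set b := 1 - (δ / 2) ^ 2 / M ^ 2 with hb
  have hδM : δ ^ 2 / M ^ 2 ≤ 1 := by
    rw [div_le_one (by positivity)]; gcongr; linarith
  have ha0 : 0 ≤ a := by linarith
  have hab : a < b := by
    have : 0 < δ ^ 2 / M ^ 2 := by positivity
    have h2 : (δ / 2) ^ 2 / M ^ 2 = δ ^ 2 / M ^ 2 / 4 := by ring
    rw [ha, hb, h2]; linarith
  have hb0 : 0 < b := by linarith
  have hw01 : ∀ y : E n, ‖y‖ ≤ M → 0 ≤ 1 - ‖y‖ ^ 2 / M ^ 2 := by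
    intro y hy
    rw [sub_nonneg, div_le_one (by positivity)]; gcongr
  have hup : ∀ k, ∫ x in B, w k (x + (1 : ℝ) • h x) * J 1 x ≤ a ^ k * C * volume.real B := by
    intro k
    have := norm_setIntegral_le_of_norm_le_const (μ := (volume : Measure (E n))) (s := B)
      (f := fun x => w k (x + (1 : ℝ) • h x) * J 1 x) (C := a ^ k * C) hBc.measure_lt_top
      (by
        intro x hx
        rw [norm_mul]
        have h1 := hw01 _ (hM x hx)
        refine mul_le_mul ?_ (hC x hx) (norm_nonneg _) (by positivity)
        simp only [w, one_smul]
        rw [Real.norm_of_nonneg (by positivity)]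
        refine pow_le_pow_left₀ h1 ?_ k
        rw [ha]
        gcongr
        exact hδ x hx)
    exact (le_abs_self _).trans this
  have hlow : ∀ k, b ^ k * volume.real (Metric.closedBall (0 : E n) (δ / 2)) ≤ ∫ x in B, w k x := by
    intro k
    have hsub : Metric.closedBall (0 : E n) (δ / 2) ⊆ B := Metric.closedBall_subset_closedBall
      (by linarith)
    calc b ^ k * volume.real (Metric.closedBall (0 : E n) (δ / 2))
        = ∫ x in Metric.closedBall (0 : E n) (δ / 2), b ^ k := by
          rw [setIntegral_const, smul_eq_mul, mul_comm]
      _ ≤ ∫ x in Metric.closedBall (0 : E n) (δ / 2), w k x := by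
          refine setIntegral_mono_on ?_ ?_ measurableSet_closedBall ?_
          · exact continuous_const.continuousOn.integrableOn_compact (isCompact_closedBall _ _)
          · exact (hwc k).continuousOn.integrableOn_compact (isCompact_closedBall _ _)
          · intro x hx
            rw [mem_closedBall_zero_iff] at hx
            refine pow_le_pow_left₀ hb0.le ?_ k
            rw [hb]
            gcongr
      _ ≤ _ := by
          refine setIntegral_mono_set ((hwc k).continuousOn.integrableOn_compact hBc) ?_
            hsub.eventuallyLE
          filter_upwards [ae_restrict_mem measurableSet_closedBall] with x hx
          rw [mem_closedBall_zero_iff] at hx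
          have := hw01 x (hx.trans hMR)
          simp only [w, Pi.zero_apply]
          positivity
  set V := volume.real (Metric.closedBall (0 : E n) (δ / 2))
  have hV : 0 < V := ENNReal.toReal_pos
    (Metric.measure_closedBall_pos volume (0 : E n) (by positivity)).ne'
    (isCompact_closedBall (0 : E n) (δ / 2)).measure_lt_top.ne
  set C' := C * volume.real B
  have hineq : ∀ k, V ≤ (a / b) ^ k * C' := by
    intro k
    have h1 := (hlow k).trans ((hkey k).symm.le.trans (hup k))
    rw [div_pow, div_mul_eq_mul_div, le_div_iff₀ (by positivity), mul_comm]
    simpa only [C', mul_assoc] using h1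
  have hlim : Tendsto (fun k : ℕ => (a / b) ^ k * C') atTop (𝓝 (0 * C')) :=
    (tendsto_pow_atTop_nhds_zero_of_lt_one (by positivity) ((div_lt_one hb0).2 hab)).mul_const _
  have := ge_of_tendsto' hlim hineq
  linarith

end BrouwerDegree

/-- Approximate h by a smooth g with pointwise error less than ‖x + h(x)‖; at a zero of x + g(x) the
error would equal that bound. -/
theorem Continuous.exists_add_eq_zero_of_hasCompactSupport {n : ℕ} {h : E n → E n}
    (hh : Continuous h) (hc : HasCompactSupport h) : ∃ x, x + h x = 0 := by
  by_contra hne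
  push Not at hne
  obtain ⟨g, hg, hgh, hsupp⟩ := hh.exists_contDiff_approx 1
    (ε := fun x => ‖x + h x‖) (continuous_id.add hh).norm (fun x => norm_pos_iff.2 (hne x))
  have hgc : HasCompactSupport g := hc.mono hsupp
  obtain ⟨x, hx⟩ := ContDiff.exists_add_eq_zero_of_hasCompactSupport
    (by exact_mod_cast hg) hgc
  have h1 := hgh x
  rw [dist_eq_norm, ← norm_neg, neg_sub, ← add_sub_add_left_eq_sub _ _ x, hx, sub_zero] at h1
  exact lt_irrefl _ h1

/-- The Poincaré–Miranda theorem. -/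
theorem ContinuousOn.exists_eq_zero_of_miranda {n : ℕ} {F : (Fin n → ℝ) → Fin n → ℝ}
    (hF : ContinuousOn F (Icc (-1) 1)) (hpos : ∀ x ∈ Icc (-1 : Fin n → ℝ) 1, ∀ i, x i = 1 → 0 ≤ F x i)
    (hneg : ∀ x ∈ Icc (-1 : Fin n → ℝ) 1, ∀ i, x i = -1 → F x i ≤ 0) :
    ∃ x ∈ Icc (-1 : Fin n → ℝ) 1, F x = 0 := by
  let c : (Fin n → ℝ) → Fin n → ℝ := fun x i => max (-1) (min 1 (x i))
  have hc : Continuous c := by fun_prop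
  have hcI : ∀ x, c x ∈ Icc (-1 : Fin n → ℝ) 1 := fun x =>
    ⟨fun i => le_max_left _ _, fun i => max_le (by norm_num) (min_le_left _ _)⟩
  let χ : (Fin n → ℝ) → ℝ := fun x => max 0 (min 1 (2 - ‖x‖))
  have hχ : Continuous χ := by fun_prop
  have hχ0 : ∀ x, 0 ≤ χ x := fun x => le_max_left _ _
  have hχ1 : ∀ x, χ x ≤ 1 := fun x => max_le zero_le_one (min_le_left _ _)
  let e := EuclideanSpace.equiv (Fin n) ℝ
  -- With c the retraction onto the cube and χ a cutoff, a zero of x + k(x) lies in the cube: if x i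
  -- > 1 then F (c x) i ≥ 0 and the i-th coordinate is at least x i - χ x > 0, and symmetrically
  -- below -1. On the cube χ = 1 and c is the identity, so F vanishes there.
  let k : (Fin n → ℝ) → Fin n → ℝ := fun x => χ x • (F (c x) - c x)
  have hk : Continuous k := by
    have : Continuous fun x => F (c x) := hF.comp_continuous hc hcI
    exact hχ.smul (this.sub hc)
  have hsupp : HasCompactSupport fun y : E n => e.symm (k (e y)) := by
    refine HasCompactSupport.intro
      ((isCompact_closedBall (0 : Fin n → ℝ) 2).image e.symm.continuous) fun y hy => ?_
    have : χ (e y) = 0 := by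
      have h2 : 2 < ‖e y‖ := by
        by_contra hle
        push Not at hle
        exact hy ⟨e y, by simpa using hle, by simp⟩
      exact max_eq_left ((min_le_right _ _).trans (by linarith))
    simp [k, this]
  obtain ⟨y, hy⟩ := Continuous.exists_add_eq_zero_of_hasCompactSupport
    (h := fun y : E n => e.symm (k (e y))) (e.symm.continuous.comp (hk.comp e.continuous)) hsupp
  set x := e y with hx
  have hx0 : x + k x = 0 := by
    have := congrArg e hy
    simpa [hx] using this
  have hxi : ∀ i, x i + χ x * (F (c x) i - c x i) = 0 := fun i => congrFun hx0 i
  have hle : ∀ i, x i ≤ 1 := by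
    intro i
    by_contra h1
    push Not at h1
    have hci : c x i = 1 := by simp [c, min_eq_left h1.le]
    have := hpos _ (hcI x) i hci
    have h2 := hxi i
    rw [hci] at h2
    nlinarith [hχ0 x, hχ1 x, mul_nonneg (hχ0 x) this]
  have hge : ∀ i, -1 ≤ x i := by
    intro i
    by_contra h1
    push Not at h1
    have hci : c x i = -1 := by
      simp only [c]
      rw [min_eq_right (by linarith), max_eq_left h1.le]
    have := hneg _ (hcI x) i hci
    have h2 := hxi i
    rw [hci] at h2
    nlinarith [hχ0 x, hχ1 x, mul_nonneg (hχ0 x) (neg_nonneg.2 this)]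
  have hcx : c x = x := by
    ext i
    simp only [c]
    rw [min_eq_right (hle i), max_eq_right (hge i)]
  have hn : ‖x‖ ≤ 1 := by
    rw [pi_norm_le_iff_of_nonneg zero_le_one]
    exact fun i => abs_le.2 ⟨hge i, hle i⟩
  have hχx : χ x = 1 := by
    simp only [χ]
    rw [min_eq_left (by linarith), max_eq_right zero_le_one]
  refine ⟨x, ⟨fun i => hge i, fun i => hle i⟩, ?_⟩
  ext i
  have := hxi i
  rw [hχx, hcx] at this
  simp only [Pi.zero_apply]
  linarith

/-! ### Finite-to-one images of separating sets -/

/-- A continuous map with finite fibres on a compact subset of a metric space has, near every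
point of the image, a locally constant approximate inverse. -/
theorem IsCompact.exists_continuousOn_finite_range_of_finite_fibres {X Y : Type*} [MetricSpace X]
    [MetricSpace Y] {K : Set X} (hK : IsCompact K) {F : X → Y} (hF : ContinuousOn F K) (y : Y)
    (hfin : {x | x ∈ K ∧ F x = y}.Finite) [Nonempty X] {η : ℝ} (hη : 0 < η) :
    ∃ s > 0, ∃ q : X → X, (range q).Finite ∧ ContinuousOn q (K ∩ F ⁻¹' Metric.ball y s) ∧
      ∀ x ∈ K ∩ F ⁻¹' Metric.ball y s, dist (q x) x < η := by
  classical
  set Z := {x | x ∈ K ∧ F x = y} with hZ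
  obtain ⟨δ, hδ0, hδη, hδ⟩ : ∃ δ > 0, δ ≤ η ∧ ∀ a ∈ Z, ∀ b ∈ Z, a ≠ b → 2 * δ ≤ dist a b := by
    obtain ⟨δ, hδ, hsep⟩ : ∃ δ > 0, ∀ a ∈ Z, ∀ b ∈ Z, a ≠ b → δ ≤ dist a b := by
      have h1 : (Z.offDiag).Finite := hfin.offDiag
      rcases Z.offDiag.eq_empty_or_nonempty with he | hne
      · refine ⟨1, one_pos, fun a ha b hb hab => ?_⟩
        have : (a, b) ∈ Z.offDiag := ⟨ha, hb, hab⟩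
        simp [he] at this
      · obtain ⟨⟨a, b⟩, ⟨_, _, hab⟩, hmin⟩ :=
          Set.exists_min_image _ (fun p : X × X => dist p.1 p.2) h1 hne
        exact ⟨dist a b, dist_pos.2 hab, fun a' ha' b' hb' hab' => hmin (a', b') ⟨ha', hb', hab'⟩⟩
    refine ⟨min (δ / 2) η, by positivity, min_le_right _ _, fun a ha b hb hab => ?_⟩
    have := hsep a ha b hb hab
    have := min_le_left (δ / 2) η
    linarith
  set V := ⋃ a ∈ Z, Metric.ball a δ with hV
  have hVo : IsOpen V := isOpen_biUnion fun a _ => Metric.isOpen_ball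
  have hKV : IsCompact (K \ V) := hK.diff hVo
  have himg : IsCompact (F '' (K \ V)) := hKV.image_of_continuousOn (hF.mono sdiff_subset)
  have hynot : y ∉ F '' (K \ V) := by
    rintro ⟨x, ⟨hxK, hxV⟩, hxy⟩
    exact hxV (mem_biUnion (show x ∈ Z from ⟨hxK, hxy⟩) (Metric.mem_ball_self hδ0))
  -- The part of K outside the δ-balls around the fibre has compact image missing y; q will send
  -- each remaining point to the fibre point near it.
  obtain ⟨s, hs, hsub⟩ := Metric.isOpen_iff.1 himg.isClosed.isOpen_compl y hynot
  let q : X → X := fun x => if h : ∃ a ∈ Z, dist x a < δ then h.choose else Classical.arbitrary X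
  have huniq : ∀ x a b, a ∈ Z → b ∈ Z → dist x a < δ → dist x b < δ → a = b := by
    intro x a b ha hb hxa hxb
    by_contra hab
    have := hδ a ha b hb hab
    have := dist_triangle_left a b x
    linarith
  have hq : ∀ x a, a ∈ Z → dist x a < δ → q x = a := by
    intro x a ha hxa
    have h : ∃ a ∈ Z, dist x a < δ := ⟨a, ha, hxa⟩
    simp only [q, dif_pos h]
    exact huniq x _ _ h.choose_spec.1 ha h.choose_spec.2 hxa
  have hcov : ∀ x ∈ K ∩ F ⁻¹' Metric.ball y s, ∃ a ∈ Z, dist x a < δ := by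
    rintro x ⟨hxK, hxs⟩
    by_contra hno
    push Not at hno
    refine hsub hxs ⟨x, ⟨hxK, fun hxV => ?_⟩, rfl⟩
    obtain ⟨a, ha, hxa⟩ := mem_iUnion₂.1 hxV
    exact absurd hxa (not_lt.2 (hno a ha))
  refine ⟨s, hs, q, ?_, ?_, ?_⟩
  · refine (hfin.insert (Classical.arbitrary X)).subset ?_
    rintro _ ⟨x, rfl⟩
    by_cases h : ∃ a ∈ Z, dist x a < δ
    · right
      simp only [q, dif_pos h]
      exact h.choose_spec.1
    · left; simp [q, dif_neg h]
  · intro x hx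
    obtain ⟨a, ha, hxa⟩ := hcov x hx
    refine ContinuousWithinAt.congr_of_eventuallyEq (f := fun _ => a) continuousWithinAt_const ?_
      (hq x a ha hxa)
    have : Metric.ball a δ ∈ 𝓝 x := Metric.isOpen_ball.mem_nhds hxa
    filter_upwards [mem_nhdsWithin_of_mem_nhds this] with z hz
    exact hq z a ha hz
  · intro x hx
    obtain ⟨a, ha, hxa⟩ := hcov x hx
    rw [hq x a ha hxa, dist_comm]
    linarith

theorem IsCompact.hausdorffMeasure_image_eq_zero_of_contDiffAt {A B : Type*}
    [NormedAddCommGroup A] [NormedSpace ℝ A] [MeasurableSpace A] [BorelSpace A]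
    [NormedAddCommGroup B] [NormedSpace ℝ B] [MeasurableSpace B] [BorelSpace B]
    {Z : Set A} (hZ : IsCompact Z) {d : ℝ} (hd : 0 ≤ d) (h0 : Measure.hausdorffMeasure d Z = 0)
    {G : A → B} (hG : ∀ z ∈ Z, ContDiffAt ℝ 1 G z) :
    Measure.hausdorffMeasure d (G '' Z) = 0 := by
  suffices Measure.hausdorffMeasure d (G '' (Z ∩ Z)) = 0 by rwa [inter_self] at this
  refine hZ.induction_on (p := fun s => Measure.hausdorffMeasure d (G '' (s ∩ Z)) = 0)
    (by simp) (fun s t hst ht => measure_mono_null (by gcongr) ht) (fun s t hs ht => ?_)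
    (fun z hz => ?_)
  · rw [union_inter_distrib_right, image_union]
    exact measure_union_null hs ht
  · obtain ⟨K, t, ht, hL⟩ := (hG z hz).exists_lipschitzOnWith
    refine ⟨t, mem_nhdsWithin_of_mem_nhds ht, ?_⟩
    have := (hL.mono inter_subset_left).hausdorffMeasure_image_le hd (s := t ∩ Z)
    rw [measure_mono_null inter_subset_right h0, mul_zero] at this
    exact le_antisymm this zero_le

/-- If a map with finite fibres sends a compact set onto an `ℋᵈ`-null set, then every
`1`-Lipschitz map on that set can be approximated by maps with `ℋᵈ`-null image. -/
theorem IsCompact.exists_approx_hausdorffMeasure_image_eq_zero {X Y W : Type*} [MetricSpace X]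
    [Nonempty X] [NormedAddCommGroup Y] [InnerProductSpace ℝ Y] [MeasurableSpace Y] [BorelSpace Y]
    [FiniteDimensional ℝ Y]
    [NormedAddCommGroup W] [NormedSpace ℝ W] [MeasurableSpace W] [BorelSpace W]
    {K : Set X} (hK : IsCompact K) {F : X → Y} (hF : ContinuousOn F K)
    (hfin : ∀ y, {x | x ∈ K ∧ F x = y}.Finite) {d : ℝ} (hd : 0 ≤ d)
    (h0 : Measure.hausdorffMeasure d (F '' K) = 0)
    {π : X → W} (hπ : LipschitzWith 1 π) {η : ℝ} (hη : 0 < η) :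
    ∃ Φ : X → W, ContinuousOn Φ K ∧ (∀ x ∈ K, dist (Φ x) (π x) ≤ η) ∧
      Measure.hausdorffMeasure d (Φ '' K) = 0 := by
  classical
  choose s hs q hqfin hqcont hqη using fun y =>
    hK.exists_continuousOn_finite_range_of_finite_fibres hF y (hfin y) hη
  have hZ : IsCompact (F '' K) := hK.image_of_continuousOn hF
  obtain ⟨T, -, hT⟩ := hZ.elim_nhds_subcover (fun y => Metric.ball y (s y / 2))
    (fun y _ => Metric.ball_mem_nhds y (half_pos (hs y)))
  -- The bump is supported in the ball of radius s y / 2, strictly inside the region where q y is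
  -- continuous.
  let b : ∀ y : Y, ContDiffBump y := fun y =>
    ⟨s y / 4, s y / 2, by linarith [hs y], by linarith [hs y]⟩
  let S : Y → ℝ := fun z => ∑ y ∈ T, b y z
  have hS : ∀ z ∈ F '' K, 0 < S z := by
    intro z hz
    obtain ⟨y, hy, hyz⟩ := mem_iUnion₂.1 (hT hz)
    exact Finset.sum_pos' (fun y _ => (b y).nonneg) ⟨y, hy, (b y).pos_of_mem_ball hyz⟩
  have hSc : ContDiff ℝ 1 S := ContDiff.sum fun y _ => (b y).contDiff
  -- An average of the points π (q y x) with weights from a partition of unity pulled back by F;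
  -- each is within η of π x.
  let Φ : X → W := fun x => (S (F x))⁻¹ • ∑ y ∈ T, b y (F x) • π (q y x)
  refine ⟨Φ, ?_, ?_, ?_⟩
  · have hSF : ContinuousOn (fun x => S (F x)) K := hSc.continuous.comp_continuousOn hF
    refine ContinuousOn.smul (hSF.inv₀ fun x hx => (hS _ ⟨x, hx, rfl⟩).ne') ?_
    refine continuousOn_finsetSum _ fun y _ => ?_
    intro x hx
    by_cases hxy : F x ∈ Metric.ball y (s y)
    · have hq : ContinuousWithinAt (q y) K x := by
        refine (hqcont y x ⟨hx, hxy⟩).mono_of_mem_nhdsWithin ?_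
        exact inter_mem self_mem_nhdsWithin (hF x hx (Metric.isOpen_ball.mem_nhds hxy))
      exact (((b y).continuous.comp_continuousOn hF) x hx).smul
        (hπ.continuous.continuousAt.comp_continuousWithinAt hq)
    · have hout : F x ∈ (Metric.closedBall y (s y / 2))ᶜ := by
        simp only [Metric.mem_ball, not_lt] at hxy
        simp only [mem_compl_iff, Metric.mem_closedBall, not_le]
        linarith [hs y]
      have hzero : ∀ z ∈ (Metric.closedBall y (s y / 2))ᶜ, b y z = 0 := by
        intro z hz
        simp only [mem_compl_iff, Metric.mem_closedBall, not_le] at hz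
        exact (b y).zero_of_le_dist hz.le
      refine ContinuousWithinAt.congr_of_eventuallyEq (f := fun _ => (0 : W))
        continuousWithinAt_const ?_ (by simp [hzero _ hout])
      filter_upwards [hF x hx (Metric.isClosed_closedBall.isOpen_compl.mem_nhds hout)] with z hz
      simp [hzero _ hz]
  · intro x hx
    have hSx := hS _ ⟨x, hx, rfl⟩
    have h1 : Φ x - π x = (S (F x))⁻¹ • ∑ y ∈ T, b y (F x) • (π (q y x) - π x) := by
      simp only [smul_sub, Finset.sum_sub_distrib, ← Finset.sum_smul]
      change Φ x - π x = Φ x - (S (F x))⁻¹ • S (F x) • π x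
      rw [smul_smul, inv_mul_cancel₀ hSx.ne', one_smul]
    rw [dist_eq_norm, h1, norm_smul, norm_inv, Real.norm_of_nonneg hSx.le,
      inv_mul_le_iff₀ hSx]
    calc ‖∑ y ∈ T, b y (F x) • (π (q y x) - π x)‖
        ≤ ∑ y ∈ T, ‖b y (F x) • (π (q y x) - π x)‖ := norm_sum_le _ _
      _ ≤ ∑ y ∈ T, b y (F x) * η := by
          refine Finset.sum_le_sum fun y _ => ?_
          rw [norm_smul, Real.norm_of_nonneg (b y).nonneg]
          by_cases hxy : F x ∈ Metric.ball y (s y)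
          · gcongr
            · exact (b y).nonneg
            · rw [← dist_eq_norm]
              have := hπ.dist_le_mul (q y x) x
              rw [NNReal.coe_one, one_mul] at this
              exact this.trans (hqη y x ⟨hx, hxy⟩).le
          · have : b y (F x) = 0 := (b y).zero_of_le_dist (by
              simp only [Metric.mem_ball, not_lt] at hxy
              change s y / 2 ≤ _
              linarith [hs y])
            simp [this]
      _ = S (F x) * η := by rw [← Finset.sum_mul]
  -- Each q y has finite range, so Φ takes the form G J ∘ F with only finitely many J; each G J is
  -- C¹ near F(K) and preserves null sets.
  · let Jt := ∀ y : T, range (q y)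
    have : ∀ y, Finite (range (q y)) := fun y => (hqfin y).to_subtype
    let G : Jt → Y → W := fun J z => (S z)⁻¹ • ∑ y ∈ T.attach, b y.1 z • π (J y)
    have hG : ∀ J, Measure.hausdorffMeasure d (G J '' (F '' K)) = 0 := by
      intro J
      refine hZ.hausdorffMeasure_image_eq_zero_of_contDiffAt hd h0 fun z hz => ?_
      refine (hSc.contDiffAt.inv (hS z hz).ne').smul ?_
      exact ContDiffAt.sum fun y _ => ((b y.1).contDiffAt).smul contDiffAt_const
    refine measure_mono_null ?_ (measure_iUnion_null hG)
    rintro _ ⟨x, hx, rfl⟩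
    refine mem_iUnion.2 ⟨fun y => ⟨q y x, mem_range_self x⟩, F x, ⟨x, hx, rfl⟩, ?_⟩
    simp only [G, Φ]
    rw [← Finset.sum_attach T]

/-- A relatively closed set separating two opposite faces of the cube in `ℝᵐ⁺¹` cannot be mapped
onto an `ℋᵐ`-null set by a continuous map with finite fibres. -/
theorem hausdorffMeasure_image_separator_ne_zero {m : ℕ} {Y : Type*} [NormedAddCommGroup Y]
    [InnerProductSpace ℝ Y] [MeasurableSpace Y] [BorelSpace Y] [FiniteDimensional ℝ Y]
    {F : (Fin (m + 1) → ℝ) → Y} (hF : ContinuousOn F (Icc (-1) 1))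
    (hfin : ∀ y, {x | x ∈ Icc (-1 : Fin (m + 1) → ℝ) 1 ∧ F x = y}.Finite)
    {g : (Fin (m + 1) → ℝ) → ℝ} (hg : ContinuousOn g (Icc (-1) 1))
    (hneg : ∀ x ∈ Icc (-1 : Fin (m + 1) → ℝ) 1, x (Fin.last m) = -1 → g x ≤ 0)
    (hpos : ∀ x ∈ Icc (-1 : Fin (m + 1) → ℝ) 1, x (Fin.last m) = 1 → 0 ≤ g x) :
    Measure.hausdorffMeasure m (F '' {x | x ∈ Icc (-1 : Fin (m + 1) → ℝ) 1 ∧ g x = 0}) ≠ 0 := by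
  intro h0
  set C := Icc (-1 : Fin (m + 1) → ℝ) 1 with hC
  set K := {x | x ∈ C ∧ g x = 0} with hK
  have hCc : IsCompact C := isCompact_Icc
  have hKC : K ⊆ C := fun x hx => hx.1
  have hKcl : IsClosed K := by
    have := hg.preimage_isClosed_of_isClosed isClosed_Icc (isClosed_singleton (x := (0 : ℝ)))
    exact this
  have hKc : IsCompact K := hCc.of_isClosed_subset hKcl hKC
  let π : (Fin (m + 1) → ℝ) → Fin m → ℝ := fun x i => x i.castSucc
  have hπ : LipschitzWith 1 π := by
    refine LipschitzWith.of_dist_le_mul fun x y => ?_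
    rw [NNReal.coe_one, one_mul, dist_pi_le_iff dist_nonneg]
    exact fun i => dist_le_pi_dist x y _
  obtain ⟨Φ, hΦc, hΦd, hΦ0⟩ := hKc.exists_approx_hausdorffMeasure_image_eq_zero (hF.mono hKC)
    (fun y => (hfin y).subset fun x hx => ⟨hKC hx.1, hx.2⟩) (Nat.cast_nonneg m) h0 hπ
    (η := 1 / 2) (by norm_num)
  -- On ℝᵐ with the sup norm, ℋᵐ is Lebesgue measure.
  have hvol : volume (Φ '' K) = 0 := by
    rw [← hausdorffMeasure_pi_real, Fintype.card_fin]; exact hΦ0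
  obtain ⟨c, hcb, hcΦ⟩ : ∃ c ∈ Metric.ball (0 : Fin m → ℝ) (1 / 4), c ∉ Φ '' K := by
    by_contra hno
    push Not at hno
    exact (Metric.measure_ball_pos volume (0 : Fin m → ℝ) (by norm_num : (0 : ℝ) < 1 / 4)).ne'
      (measure_mono_null hno hvol)
  -- Tietze extension of the coordinates of Φ - π from K, keeping the bound 1/2. As 1/2 + 1/4 < 1,
  -- subtracting c as well does not spoil the signs on the faces.
  have hcoord : ∀ i : Fin m, ∃ ψ : C((Fin (m + 1) → ℝ), ℝ),
      (∀ x, ψ x ∈ Icc (-(1 / 2) : ℝ) (1 / 2)) ∧ ∀ x ∈ K, ψ x = Φ x i - x i.castSucc := by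
    intro i
    let f : C(K, ℝ) := ⟨fun x => Φ x i - (x : Fin (m + 1) → ℝ) i.castSucc, by
      have h1 : Continuous fun x : K => Φ x := continuousOn_iff_continuous_domRestrict.1 hΦc
      exact ((continuous_apply i).comp h1).sub
        ((continuous_apply i.castSucc).comp continuous_subtype_val)⟩
    obtain ⟨ψ, hψ, hψf⟩ := f.exists_restrict_eq_forall_mem_of_closed
      (t := Icc (-(1 / 2) : ℝ) (1 / 2)) (fun x => by
        have h1 := (dist_le_pi_dist (Φ x) (π x) i).trans (hΦd x x.2)
        rw [Real.dist_eq, abs_le] at h1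
        exact h1) ⟨0, by norm_num, by norm_num⟩ hKcl
    exact ⟨ψ, hψ, fun x hx => congrArg (fun k : C(K, ℝ) => k ⟨x, hx⟩) hψf⟩
  choose ψ hψ hψK using hcoord
  have hci : ∀ i, |c i| < 1 / 4 := by
    intro i
    rw [mem_ball_zero_iff] at hcb
    exact (norm_le_pi_norm c i).trans_lt hcb
  -- A zero of H lies in K because its last coordinate is g, and there the other coordinates say Φ x
  -- = c.
  let H : (Fin (m + 1) → ℝ) → Fin (m + 1) → ℝ := fun x i =>
    Fin.lastCases (motive := fun _ => ℝ) (g x) (fun j => x j.castSucc + ψ j x - c j) i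
  have hHl : ∀ x, H x (Fin.last m) = g x := fun x => by simp [H]
  have hHc : ∀ x j, H x (Fin.castSucc j) = x j.castSucc + ψ j x - c j := fun x j => by simp [H]
  obtain ⟨x, hx, hx0⟩ := ContinuousOn.exists_eq_zero_of_miranda (F := H) (by
      refine continuousOn_pi.2 fun i => ?_
      refine Fin.lastCases ?_ (fun j => ?_) i
      · simpa only [hHl] using hg
      · simp only [hHc]
        fun_prop)
    (by
      intro x hx i hi
      revert hi
      refine Fin.lastCases ?_ (fun j => ?_) i
      · intro hi; rw [hHl]; exact hpos x hx hi
      · intro hi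
        rw [hHc, hi]
        have := (hψ j x).1
        have := (abs_lt.1 (hci j)).2
        linarith)
    (by
      intro x hx i hi
      revert hi
      refine Fin.lastCases ?_ (fun j => ?_) i
      · intro hi; rw [hHl]; exact hneg x hx hi
      · intro hi
        rw [hHc, hi]
        have := (hψ j x).2
        have := (abs_lt.1 (hci j)).1
        linarith)
  have hxK : x ∈ K := ⟨hx, by rw [← hHl, hx0]; rfl⟩
  refine hcΦ ⟨x, hxK, ?_⟩
  ext j
  have h1 : H x j.castSucc = 0 := by rw [hx0]; rfl
  rw [hHc, hψK j x hxK] at h1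
  linarith

theorem areaMeasure_succ (m : ℕ) : areaMeasure (m + 1) = Measure.hausdorffMeasure (m : ℝ) := by
  simp [areaMeasure]

/-! ### Positive area of the spherical sections of the image -/

/-- In a connected open set, the sets `{g < 0}` and `{g > 0}` have a common boundary point as soon
as both are non-empty and the zero set of `g` has empty interior. -/
theorem IsPreconnected.exists_mem_closure_inter_closure {X : Type*} [TopologicalSpace X] {D : Set X}
    (hD : IsOpen D) (hDc : IsPreconnected D) {g : X → ℝ} (hg : ContinuousOn g D)
    (hneg : ∃ x ∈ D, g x < 0) (hpos : ∃ x ∈ D, 0 < g x)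
    (hint : interior {x | x ∈ D ∧ g x = 0} = ∅) :
    ∃ x ∈ D, x ∈ closure {x | x ∈ D ∧ g x < 0} ∧ x ∈ closure {x | x ∈ D ∧ 0 < g x} := by
  by_contra hno
  push Not at hno
  have hA : IsOpen {x | x ∈ D ∧ g x < 0} := hg.isOpen_inter_preimage hD isOpen_Iio
  have hB : IsOpen {x | x ∈ D ∧ 0 < g x} := hg.isOpen_inter_preimage hD isOpen_Ioi
  have hdisj : Disjoint {x | x ∈ D ∧ g x < 0} {x | x ∈ D ∧ 0 < g x} := by
    rw [Set.disjoint_left]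
    rintro x ⟨_, h1⟩ ⟨_, h2⟩
    exact lt_asymm h1 h2
  have hAB := hdisj.closure_left hB
  have hBA := hdisj.closure_right hA
  obtain ⟨a, haD, ha⟩ := hneg
  obtain ⟨b, hbD, hb⟩ := hpos
  -- If the closures did not meet in D, their complements would cover D; connectedness yields a
  -- point in neither closure, and near it g vanishes identically.
  obtain ⟨x, hxD, hx1, hx2⟩ := hDc (closure {x | x ∈ D ∧ g x < 0})ᶜ
    (closure {x | x ∈ D ∧ 0 < g x})ᶜ isClosed_closure.isOpen_compl isClosed_closure.isOpen_compl
    (fun x hx => by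
      by_cases h : x ∈ closure {x | x ∈ D ∧ g x < 0}
      · exact Or.inr (hno x hx h)
      · exact Or.inl h)
    ⟨b, hbD, fun h => Set.disjoint_left.1 hAB h ⟨hbD, hb⟩⟩
    ⟨a, haD, fun h => Set.disjoint_left.1 hBA ⟨haD, ha⟩ h⟩
  have hsub : D ∩ ((closure {x | x ∈ D ∧ g x < 0})ᶜ ∩ (closure {x | x ∈ D ∧ 0 < g x})ᶜ) ⊆
      {x | x ∈ D ∧ g x = 0} := by
    rintro z ⟨hzD, hz1, hz2⟩
    refine ⟨hzD, le_antisymm ?_ ?_⟩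
    · by_contra h
      exact hz2 (subset_closure ⟨hzD, not_le.1 h⟩)
    · by_contra h
      exact hz1 (subset_closure ⟨hzD, not_le.1 h⟩)
  have hopen : IsOpen
      (D ∩ ((closure {x | x ∈ D ∧ g x < 0})ᶜ ∩ (closure {x | x ∈ D ∧ 0 < g x})ᶜ)) :=
    hD.inter (isClosed_closure.isOpen_compl.inter isClosed_closure.isOpen_compl)
  have := interior_maximal hsub hopen ⟨hxD, hx1, hx2⟩
  rw [hint] at this
  exact this

/-- Two open sets that accumulate at a common point are joined by a thin affine cube. -/
theorem exists_affine_cube {m : ℕ} {x₀ : E (m + 1)} {U A B : Set (E (m + 1))} (hU : U ∈ 𝓝 x₀)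
    (hA : IsOpen A) (hB : IsOpen B) (hAB : Disjoint A B) (hxA : x₀ ∈ closure A)
    (hxB : x₀ ∈ closure B) :
    ∃ T : (Fin (m + 1) → ℝ) → E (m + 1), Continuous T ∧ Function.Injective T ∧
      ∀ x ∈ Icc (-1 : Fin (m + 1) → ℝ) 1, T x ∈ U ∧ (x (Fin.last m) = -1 → T x ∈ A) ∧
        (x (Fin.last m) = 1 → T x ∈ B) := by
  classical
  obtain ⟨R, hR, hRU⟩ := Metric.mem_nhds_iff.1 hU
  obtain ⟨a, haR, ha⟩ := mem_closure_iff_nhds.1 hxA _ (Metric.ball_mem_nhds x₀ (half_pos hR))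
  obtain ⟨b, hbR, hb⟩ := mem_closure_iff_nhds.1 hxB _ (Metric.ball_mem_nhds x₀ (half_pos hR))
  obtain ⟨ra, hra, hraA⟩ := Metric.isOpen_iff.1 hA a ha
  obtain ⟨rb, hrb, hrbB⟩ := Metric.isOpen_iff.1 hB b hb
  have hab : a ≠ b := fun h => Set.disjoint_left.1 hAB ha (h ▸ hb)
  let e : Fin (m + 1) → ℝ := Pi.single (Fin.last m) 1
  let L₀ := (EuclideanSpace.equiv (Fin (m + 1)) ℝ).symm
  set v : E (m + 1) := (1 / 2 : ℝ) • (b - a) with hv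
  have hv0 : v ≠ 0 := smul_ne_zero (by norm_num) (sub_ne_zero.2 hab.symm)
  have he : L₀ e ≠ 0 := by
    rw [Ne, ContinuousLinearEquiv.map_eq_zero_iff]
    intro h
    have := congrFun h (Fin.last m)
    simp [e] at this
  -- The axis of the cube is mapped to the segment from a to b, which has half-vector v; the
  -- transverse directions are shrunk by τ so that the end faces stay in A and B.
  obtain ⟨S, hS⟩ := SeparatingDual.exists_continuousLinearEquiv_apply_eq (R := ℝ) he hv0
  let L := L₀.trans S
  have hLe : L e = v := hS
  set c := ‖(L : (Fin (m + 1) → ℝ) →L[ℝ] E (m + 1))‖ with hc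
  obtain ⟨τ, hτ, hτR, hτa, hτb⟩ : ∃ τ > 0, τ * c < R / 2 ∧ τ * c < ra ∧ τ * c < rb := by
    have hc0 : 0 ≤ c := norm_nonneg _
    set μ := min (R / 2) (min ra rb) with hμ
    have hμ0 : 0 < μ := by positivity
    have hlt : μ / (c + 1) * c < μ := by
      rw [div_mul_eq_mul_div, div_lt_iff₀ (by positivity)]
      nlinarith
    exact ⟨μ / (c + 1), by positivity, hlt.trans_le (min_le_left _ _),
      hlt.trans_le ((min_le_right _ _).trans (min_le_left _ _)),
      hlt.trans_le ((min_le_right _ _).trans (min_le_right _ _))⟩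
  let w : (Fin (m + 1) → ℝ) → Fin (m + 1) → ℝ := fun x => Function.update x (Fin.last m) 0
  set p : E (m + 1) := (1 / 2 : ℝ) • (a + b) with hp
  let T : (Fin (m + 1) → ℝ) → E (m + 1) := fun x => p + L (τ • w x + x (Fin.last m) • e)
  have hT : ∀ x, T x = p + x (Fin.last m) • v + L (τ • w x) := by
    intro x
    simp only [T, map_add, map_smul, hLe]
    abel
  have hdist : ∀ x ∈ Icc (-1 : Fin (m + 1) → ℝ) 1,
      dist (T x) (p + x (Fin.last m) • v) ≤ τ * c := by
    intro x hx
    rw [hT, dist_self_add_left, map_smul, norm_smul, Real.norm_of_nonneg hτ.le]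
    gcongr
    refine ((L : (Fin (m + 1) → ℝ) →L[ℝ] E (m + 1)).le_opNorm _).trans ?_
    refine mul_le_of_le_one_right (norm_nonneg _) ?_
    rw [pi_norm_le_iff_of_nonneg zero_le_one]
    intro i
    by_cases hi : i = Fin.last m
    · subst hi; simp [w]
    · simp only [w, Function.update_of_ne hi]
      exact abs_le.2 ⟨hx.1 i, hx.2 i⟩
  refine ⟨T, ?_, ?_, fun x hx => ⟨?_, fun hx1 => ?_, fun hx1 => ?_⟩⟩
  · have hw : Continuous w := continuous_id.update _ continuous_const
    refine continuous_const.add (L.continuous.comp ?_)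
    exact (hw.const_smul τ).add ((continuous_apply _).smul continuous_const)
  · intro x y hxy
    have h1 : τ • w x + x (Fin.last m) • e = τ • w y + y (Fin.last m) • e :=
      L.injective (add_left_cancel hxy)
    ext i
    have h2 := congrFun h1 i
    by_cases hi : i = Fin.last m
    · subst hi; simpa [w, e] using h2
    · simp only [w, e, Pi.add_apply, Pi.smul_apply, Function.update_of_ne hi,
        Pi.single_eq_of_ne hi, smul_eq_mul, mul_zero, add_zero] at h2
      exact mul_left_cancel₀ hτ.ne' h2
  · apply hRU
    have hmem : p + x (Fin.last m) • v ∈ Metric.ball x₀ (R / 2) := by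
      have h1 : p + x (Fin.last m) • v =
          ((1 - x (Fin.last m)) / 2) • a + ((1 + x (Fin.last m)) / 2) • b := by
        rw [hp, hv]; module
      rw [h1]
      have h2 := hx.1 (Fin.last m)
      have h3 := hx.2 (Fin.last m)
      simp only [Pi.neg_apply, Pi.one_apply] at h2 h3
      exact convex_ball x₀ (R / 2) haR hbR (by linarith) (by linarith) (by ring)
    rw [Metric.mem_ball] at hmem ⊢
    have := dist_triangle (T x) (p + x (Fin.last m) • v) x₀
    have := hdist x hx
    linarith
  · apply hraA
    have h1 : p + x (Fin.last m) • v = a := by rw [hx1, hp, hv]; module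
    have := hdist x hx
    rw [h1] at this
    exact this.trans_lt hτa
  · apply hrbB
    have h1 : p + x (Fin.last m) • v = b := by rw [hx1, hp, hv]; module
    have := hdist x hx
    rw [h1] at this
    exact this.trans_lt hτb

/-- A continuous map of a domain with finite fibres and the `N⁻¹`-property meets in positive area
every sphere that separates its image. -/
theorem areaMeasure_sphere_inter_image_ne_zero {m : ℕ} {D : Set (E (m + 1))} (hD : IsOpen D)
    (hDc : IsPreconnected D) {f : E (m + 1) → E (m + 1)} (hf : ContinuousOn f D)
    (hNinv : LuzinNInv f D) (hfin : ∀ y, {x | x ∈ D ∧ f x = y}.Finite) {y₀ : E (m + 1)} {r : ℝ}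
    (hin : ∃ x ∈ D, dist (f x) y₀ < r) (hout : ∃ x ∈ D, r < dist (f x) y₀) :
    areaMeasure (m + 1) (Metric.sphere y₀ r ∩ f '' D) ≠ 0 := by
  intro h0
  rw [areaMeasure_succ] at h0
  let g : E (m + 1) → ℝ := fun x => dist (f x) y₀ - r
  have hg : ContinuousOn g D := ((continuous_id.dist continuous_const).comp_continuousOn hf).sub continuousOn_const
  have hnull : volume {x | x ∈ D ∧ g x = 0} = 0 := by
    have h1 := hNinv (Metric.sphere y₀ r) (Measure.addHaar_sphere volume y₀ r)
    refine measure_mono_null ?_ h1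
    rintro x ⟨hxD, hx⟩
    exact ⟨hxD, sub_eq_zero.1 hx⟩
  -- The zero set is null by the N⁻¹-property, since spheres are null.
  have hint : interior {x | x ∈ D ∧ g x = 0} = ∅ := interior_eq_empty_iff_dense_compl.2
    (by
      have : volume ({x | x ∈ D ∧ g x = 0}ᶜ)ᶜ = 0 := by rwa [compl_compl]
      exact Measure.dense_of_ae (μ := volume) (p := fun x => x ∈ {x | x ∈ D ∧ g x = 0}ᶜ)
        (mem_ae_iff.2 this))
  obtain ⟨x₀, hx₀, hxA, hxB⟩ := hDc.exists_mem_closure_inter_closure hD hg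
    (by obtain ⟨x, hx, h⟩ := hin; exact ⟨x, hx, sub_neg.2 h⟩)
    (by obtain ⟨x, hx, h⟩ := hout; exact ⟨x, hx, sub_pos.2 h⟩) hint
  obtain ⟨T, hTc, hTi, hT⟩ := exists_affine_cube (hD.mem_nhds hx₀)
    (hg.isOpen_inter_preimage hD isOpen_Iio) (hg.isOpen_inter_preimage hD isOpen_Ioi)
    (by
      rw [Set.disjoint_left]
      rintro x ⟨_, h1⟩ ⟨_, h2⟩
      rw [mem_preimage, mem_Ioi] at h2
      exact lt_asymm h1 h2) hxA hxB
  have hmaps : MapsTo T (Icc (-1 : Fin (m + 1) → ℝ) 1) D := fun x hx => (hT x hx).1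
  refine hausdorffMeasure_image_separator_ne_zero (F := f ∘ T) (g := g ∘ T)
    (hf.comp hTc.continuousOn hmaps) (fun y => ?_) (hg.comp hTc.continuousOn hmaps)
    (fun x hx h => ((hT x hx).2.1 h).2.le) (fun x hx h => ((hT x hx).2.2 h).2.le)
    (measure_mono_null ?_ h0)
  · refine ((hfin y).preimage hTi.injOn).subset ?_
    rintro x ⟨hx, hxy⟩
    exact ⟨hmaps hx, hxy⟩
  · rintro _ ⟨x, ⟨hx, hgx⟩, rfl⟩
    exact ⟨sub_eq_zero.1 hgx, T x, hmaps hx, rfl⟩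

/-! ### Slicing null sets by spheres -/

/-- Almost every level set of a `1`-Lipschitz function meets an `ℋᵈ⁺¹`-null set in an `ℋᵈ`-null
set. -/
theorem LipschitzWith.ae_hausdorffMeasure_inter_preimage_eq_zero {X : Type*} [MetricSpace X]
    [MeasurableSpace X] [BorelSpace X] {u : X → ℝ} (hu : LipschitzWith 1 u) {d : ℝ} (hd : 0 < d)
    {Z : Set X} (hZ : Measure.hausdorffMeasure (d + 1) Z = 0) :
    ∀ᵐ r, Measure.hausdorffMeasure d (Z ∩ u ⁻¹' {r}) = 0 := by
  have hd1 : 0 < d + 1 := by linarith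
  have hcov : ∀ j : ℕ, ∃ t : ℕ → Set X, Z ⊆ ⋃ i, t i ∧
      (∀ i, Metric.ediam (t i) ≤ (2⁻¹ : ℝ≥0∞) ^ j) ∧
      ∑' i, Metric.ediam (t i) ^ (d + 1) ≤ (2⁻¹ : ℝ≥0∞) ^ j := by
    intro j
    have hpos : (0 : ℝ≥0∞) < (2⁻¹ : ℝ≥0∞) ^ j := by
      exact ENNReal.pow_pos (by simp) j
    have h1 := hZ
    rw [Measure.hausdorffMeasure_apply] at h1
    have h2 : (⨅ (t : ℕ → Set X) (_ : Z ⊆ ⋃ n, t n)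
        (_ : ∀ n, Metric.ediam (t n) ≤ (2⁻¹ : ℝ≥0∞) ^ j),
          ∑' n, ⨆ _ : (t n).Nonempty, Metric.ediam (t n) ^ (d + 1)) < (2⁻¹ : ℝ≥0∞) ^ j := by
      refine lt_of_le_of_lt ?_ hpos
      rw [← h1]
      exact le_iSup₂_of_le (f := fun (r : ℝ≥0∞) (_ : 0 < r) =>
        ⨅ (t : ℕ → Set X) (_ : Z ⊆ ⋃ n, t n) (_ : ∀ n, Metric.ediam (t n) ≤ r),
          ∑' n, ⨆ _ : (t n).Nonempty, Metric.ediam (t n) ^ (d + 1)) _ hpos le_rfl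
    simp only [iInf_lt_iff] at h2
    obtain ⟨t, ht1, ht2, ht3⟩ := h2
    refine ⟨t, ht1, ht2, le_trans (ENNReal.tsum_le_tsum fun i => ?_) ht3.le⟩
    rcases (t i).eq_empty_or_nonempty with he | hne
    · simp [he, hd1]
    · exact le_iSup (fun _ : (t i).Nonempty => Metric.ediam (t i) ^ (d + 1)) hne
  choose t htZ htd hts using hcov
  have htop : ∀ j i, Metric.ediam (t j i) ≠ ⊤ := fun j i =>
    ((htd j i).trans_lt (ENNReal.pow_lt_top (by simp))).ne
  have hS : ∀ j i, ∃ S : Set ℝ, MeasurableSet S ∧ u '' t j i ⊆ S ∧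
      volume S ≤ 2 * Metric.ediam (t j i) := by
    intro j i
    rcases (t j i).eq_empty_or_nonempty with he | ⟨x, hx⟩
    · exact ⟨∅, MeasurableSet.empty, by simp [he], by simp⟩
    · refine ⟨Metric.closedBall (u x) (Metric.ediam (t j i)).toReal, measurableSet_closedBall,
        ?_, ?_⟩
      · rintro _ ⟨z, hz, rfl⟩
        rw [Metric.mem_closedBall, dist_edist]
        refine ENNReal.toReal_mono (htop j i) ((hu z x).trans ?_)
        rw [ENNReal.coe_one, one_mul]
        exact Metric.edist_le_ediam_of_mem hz hx
      · rw [Real.volume_closedBall, ENNReal.ofReal_mul zero_le_two, ENNReal.ofReal_toReal (htop j i)]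
        simp
  choose S hSm hSu hSv using hS
  -- φ j r bounds the d-dimensional cost of covering the slice at level r. Its integral is at most 2
  -- · 2⁻ʲ, because u (t j i) lies in an interval of length 2 diam (t j i); summability in j forces
  -- φ j r → 0 for almost every r.
  let φ : ℕ → ℝ → ℝ≥0∞ := fun j r =>
    ∑' i, (S j i).indicator (fun _ => Metric.ediam (t j i) ^ d) r
  have hφm : ∀ j, Measurable (φ j) := fun j =>
    Measurable.tsum fun i => measurable_const.indicator (hSm j i)
  have hφi : ∀ j, ∫⁻ r, φ j r ≤ 2 * (2⁻¹ : ℝ≥0∞) ^ j := by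
    intro j
    rw [lintegral_tsum fun i => (measurable_const.indicator (hSm j i)).aemeasurable]
    calc ∑' i, ∫⁻ r, (S j i).indicator (fun _ => Metric.ediam (t j i) ^ d) r
        ≤ ∑' i, 2 * Metric.ediam (t j i) ^ (d + 1) := by
          refine ENNReal.tsum_le_tsum fun i => ?_
          rw [lintegral_indicator_const (hSm j i)]
          rw [ENNReal.rpow_add_of_nonneg _ _ hd.le zero_le_one, ENNReal.rpow_one, mul_left_comm]
          gcongr
          exact hSv j i
      _ = 2 * ∑' i, Metric.ediam (t j i) ^ (d + 1) := ENNReal.tsum_mul_left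
      _ ≤ _ := by gcongr; exact hts j
  have hsum : ∫⁻ r, ∑' j, φ j r ≠ ⊤ := by
    rw [lintegral_tsum fun j => (hφm j).aemeasurable]
    refine ne_top_of_le_ne_top ?_ (ENNReal.tsum_le_tsum hφi)
    rw [ENNReal.tsum_mul_left, ENNReal.tsum_geometric]
    refine ENNReal.mul_ne_top (by simp) ?_
    simp
  filter_upwards [ae_lt_top (Measurable.tsum hφm) hsum] with r hr
  have hlim : Tendsto (fun j => φ j r) atTop (𝓝 0) :=
    ENNReal.tendsto_atTop_zero_of_tsum_ne_top hr.ne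
  classical
  -- Sets irrelevant to level r are replaced by ∅, which costs 0 ^ d = 0 because d > 0.
  let T : ∀ j : ℕ, ℕ → Set X := fun j i => if r ∈ S j i then t j i else ∅
  have hle := Measure.hausdorffMeasure_le_liminf_tsum (ι := fun _ : ℕ => ℕ) d (Z ∩ u ⁻¹' {r})
    (l := atTop) (fun j => (2⁻¹ : ℝ≥0∞) ^ j)
    (ENNReal.tendsto_pow_atTop_nhds_zero_of_lt_one (by simp)) T
    (Eventually.of_forall fun j i => by
      by_cases h : r ∈ S j i
      · simpa [T, h] using htd j i
      · simp [T, h])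
    (Eventually.of_forall fun j => by
      rintro x ⟨hxZ, hxr⟩
      obtain ⟨i, hi⟩ := mem_iUnion.1 (htZ j hxZ)
      have : r ∈ S j i := hSu j i ⟨x, hi, hxr⟩
      exact mem_iUnion.2 ⟨i, by simpa [T, this] using hi⟩)
  have heq : (fun j => ∑' i, Metric.ediam (T j i) ^ d) = fun j => φ j r := by
    ext j
    refine tsum_congr fun i => ?_
    by_cases h : r ∈ S j i
    · simp [T, h]
    · simp [T, h, hd]
  rw [heq, hlim.liminf_eq] at hle
  exact le_antisymm hle zero_le

theorem ae_areaMeasure_inter_sphere_eq_zero {m : ℕ} (hm : 0 < m) (y₀ : E (m + 1))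
    {Z : Set (E (m + 1))} (hZ : volume Z = 0) :
    ∀ᵐ r, areaMeasure (m + 1) (Z ∩ Metric.sphere y₀ r) = 0 := by
  have hH : Measure.hausdorffMeasure ((m : ℝ) + 1) Z = 0 := by
    have h := isAddHaarMeasure_hausdorffMeasure (E := E (m + 1))
    have h1 : ((Module.finrank ℝ (E (m + 1)) : ℕ) : ℝ) = (m : ℝ) + 1 := by
      rw [finrank_euclideanSpace_fin]; push_cast; rfl
    rw [h1] at h
    exact (Measure.absolutelyContinuous_isAddHaarMeasure
      (Measure.hausdorffMeasure ((m : ℝ) + 1)) volume) hZ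
  rw [areaMeasure_succ]
  exact (LipschitzWith.dist_left y₀).ae_hausdorffMeasure_inter_preimage_eq_zero
    (by exact_mod_cast hm) hH

/-- In polar coordinates Lebesgue measure is a product whose radial factor is absolutely continuous.
-/
theorem volume_preimage_dist_eq_zero {m : ℕ} (y₀ : E (m + 1)) {A : Set ℝ} (hA : volume A = 0) :
    volume {y : E (m + 1) | dist y y₀ ∈ A} = 0 := by
  wlog hAm : MeasurableSet A generalizing A
  · refine measure_mono_null ?_ (this (A := toMeasurable volume A)
      (by rwa [measure_toMeasurable]) (measurableSet_toMeasurable _ _))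
    exact fun y hy => subset_toMeasurable _ _ hy
  have hnorm : volume {y : E (m + 1) | ‖y‖ ∈ A} = 0 := by
    have hmp := (volume : Measure (E (m + 1))).measurePreserving_homeomorphUnitSphereProd
    have hnull : (Measure.volumeIoiPow (Module.finrank ℝ (E (m + 1)) - 1))
        (Subtype.val ⁻¹' A) = 0 := by
      refine withDensity_absolutelyContinuous _ _ ?_
      rw [(MeasurableEmbedding.subtype_coe measurableSet_Ioi).comap_apply]
      exact measure_mono_null (image_preimage_subset _ _) hA
    have h2 : ((volume : Measure (E (m + 1))).toSphere.prod
        (Measure.volumeIoiPow (Module.finrank ℝ (E (m + 1)) - 1)))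
        (univ ×ˢ (Subtype.val ⁻¹' A)) = 0 := by
      rw [Measure.prod_prod, hnull, mul_zero]
    have h3 := hmp.measure_preimage
      (MeasurableSet.univ.prod (measurable_subtype_coe hAm)).nullMeasurableSet
    rw [h2, (MeasurableEmbedding.subtype_coe (measurableSet_singleton _).compl).comap_apply] at h3
    have h4 : volume ({0} : Set (E (m + 1))) = 0 := measure_singleton _
    refine measure_mono_null ?_ (measure_union_null h3 h4)
    intro y hy
    by_cases h0 : y = 0
    · right; exact h0
    · left
      refine ⟨⟨y, h0⟩, ⟨mem_univ _, ?_⟩, rfl⟩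
      simpa using hy
  have hm := (measurePreserving_sub_right (volume : Measure (E (m + 1))) y₀).measure_preimage
    (s := {y | ‖y‖ ∈ A}) (measurable_norm hAm).nullMeasurableSet
  rw [hnorm] at hm
  simp only [dist_eq_norm]
  exact hm

/-! ### Distortion of area in hyperplanes -/

section Hyperplane

variable {V : Type*} [NormedAddCommGroup V] [InnerProductSpace ℝ V] [FiniteDimensional ℝ V]

open Module in
/-- A linear automorphism preserving a hyperplane `W` changes volumes in `W` by a factor of at most
`‖e⁻¹‖ |det e|`. -/
theorem ContinuousLinearEquiv.abs_det_restrict_le (e : V ≃L[ℝ] V) {W : Submodule ℝ V}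
    (hW : finrank ℝ W + 1 = finrank ℝ V)
    (he : W ≤ W.comap (e : V →ₗ[ℝ] V)) :
    |((e : V →ₗ[ℝ] V).restrict he).det| ≤
      ‖(e.symm : V →L[ℝ] V)‖ * |((e : V →L[ℝ] V) : V →ₗ[ℝ] V).det| := by
  set e' : V →ₗ[ℝ] V := (e : V →ₗ[ℝ] V) with he'
  -- The determinant is the one on W times the scalar c by which e acts on the line V ⧸ W, so it
  -- suffices to show 1 ≤ |c| ‖e⁻¹‖. For a unit normal ν one has ν = w + c e⁻¹ν with w ∈ W; pairing
  -- with ν gives this.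
  have hdet : e'.det = (e'.restrict he).det * (W.mapQ W e' he).det := LinearMap.det_eq_det_mul_det W e' he
  have hQ : finrank ℝ (V ⧸ W) = 1 := by
    have := W.finrank_quotient_add_finrank
    omega
  have hWp : finrank ℝ Wᗮ = 1 := by
    have := W.finrank_add_finrank_orthogonal
    omega
  obtain ⟨c, hc, -⟩ := LinearMap.existsUnique_eq_smul_id_of_finrank_eq_one hQ (W.mapQ W e' he)
  have hcdet : (W.mapQ W e' he).det = c := by
    rw [hc, LinearMap.det_smul, hQ]; simp
  obtain ⟨ν, hν, hν1⟩ : ∃ ν ∈ Wᗮ, ‖ν‖ = 1 := by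
    obtain ⟨v, hv, -⟩ := finrank_eq_one_iff'.1 hWp
    have hv0 : ‖(v : V)‖ ≠ 0 := by simpa using hv
    refine ⟨‖(v : V)‖⁻¹ • (v : V), Wᗮ.smul_mem _ v.2, ?_⟩
    rw [norm_smul, norm_inv, norm_norm, inv_mul_cancel₀ hv0]
  have hmem : e ν - c • ν ∈ W := by
    rw [← Submodule.Quotient.mk_eq_zero, Submodule.Quotient.mk_sub, sub_eq_zero]
    have := LinearMap.congr_fun hc (Submodule.Quotient.mk ν)
    exact this
  have hinj : Function.Injective (e'.restrict he) := by
    intro x y hxy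
    have := congrArg Subtype.val hxy
    exact Subtype.ext (e.injective this)
  obtain ⟨w, hw⟩ := (LinearMap.injective_iff_surjective.1 hinj) ⟨e ν - c • ν, hmem⟩
  have hew : e (w : V) = e ν - c • ν := congrArg Subtype.val hw
  have hνeq : ν = w + c • e.symm ν := by
    apply e.injective
    rw [map_add, e.map_smul, e.apply_symm_apply, hew]
    abel
  have hone : 1 ≤ |c| * ‖(e.symm : V →L[ℝ] V)‖ := by
    have h1 : inner ℝ ν ν = c * inner ℝ ν (e.symm ν) := by
      conv_lhs => rw [show inner ℝ ν ν = inner ℝ ν (w + c • e.symm ν) by rw [← hνeq]]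
      rw [inner_add_right, inner_smul_right, Submodule.inner_left_of_mem_orthogonal w.2 hν, zero_add]
    rw [real_inner_self_eq_norm_sq, hν1] at h1
    have h2 : |inner ℝ ν (e.symm ν)| ≤ ‖(e.symm : V →L[ℝ] V)‖ := by
      refine (abs_real_inner_le_norm _ _).trans ?_
      rw [hν1, one_mul]
      simpa [hν1] using (e.symm : V →L[ℝ] V).le_opNorm ν
    calc (1 : ℝ) = |c| * |inner ℝ ν (e.symm ν)| := by rw [← abs_mul, ← h1]; norm_num
      _ ≤ _ := by gcongr
  change |(e'.restrict he).det| ≤ ‖(e.symm : V →L[ℝ] V)‖ * |e'.det|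
  rw [hdet, hcdet, abs_mul]
  nlinarith [abs_nonneg (e'.restrict he).det]

open Module in
-- Composing M with an isometry that carries M(W) back to W reduces to the invariant case, with the
-- same |det| and no larger inverse norm.
theorem ContinuousLinearEquiv.normDet_comp_subtype_le (M : V ≃L[ℝ] V) {W : Submodule ℝ V}
    (hW : finrank ℝ W + 1 = finrank ℝ V) :
    ((M : V →ₗ[ℝ] V) ∘ₗ W.subtype).normDet ≤
      ‖(M.symm : V →L[ℝ] V)‖ * |(M : V →L[ℝ] V).det| := by
  set W' := W.map (M : V →ₗ[ℝ] V) with hW'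
  have hfr : finrank ℝ W' = finrank ℝ W := LinearEquiv.finrank_map_eq M.toLinearEquiv W
  let ι : W' ≃ₗᵢ[ℝ] W := (stdOrthonormalBasis ℝ W').equiv (stdOrthonormalBasis ℝ W) (finCongr hfr)
  let R : V →ₗᵢ[ℝ] V := (W.subtypeₗᵢ.comp ι.toLinearIsometry).extend
  let R' : V ≃ₗᵢ[ℝ] V := R.toLinearIsometryEquiv rfl
  let e : V ≃L[ℝ] V := M.trans R'.toContinuousLinearEquiv
  have hRe : ∀ x, e x = R (M x) := fun x => rfl
  have he : W ≤ W.comap (e : V →ₗ[ℝ] V) := by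
    intro x hx
    have hx' : M x ∈ W' := ⟨x, hx, rfl⟩
    change R (M x) ∈ W
    have : R (M x) = (ι ⟨M x, hx'⟩ : V) :=
      (W.subtypeₗᵢ.comp ι.toLinearIsometry).extend_apply ⟨M x, hx'⟩
    rw [this]
    exact (ι ⟨M x, hx'⟩).2
  have h1 := ContinuousLinearEquiv.abs_det_restrict_le e hW he
  have h2 : ((M : V →ₗ[ℝ] V) ∘ₗ W.subtype).normDet = |((e : V →ₗ[ℝ] V).restrict he).det| := by
    have h3 : ((e : V →ₗ[ℝ] V) ∘ₗ W.subtype).normDet =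
        ((M : V →ₗ[ℝ] V) ∘ₗ W.subtype).normDet := by
      have : (e : V →ₗ[ℝ] V) ∘ₗ W.subtype = R.toLinearMap ∘ₗ ((M : V →ₗ[ℝ] V) ∘ₗ W.subtype) := rfl
      rw [this, LinearMap.normDet_comp]
      have : (R.toLinearMap.domRestrict ((M : V →ₗ[ℝ] V) ∘ₗ W.subtype).range).normDet = 1 :=
        (R.comp ((M : V →ₗ[ℝ] V) ∘ₗ W.subtype).range.subtypeₗᵢ).normDet_eq_one
      rw [this, one_mul]
    rw [← LinearMap.normDet_eq_abs_det, ← h3]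
    exact (LinearMap.normDet_codRestrict (f := (e : V →ₗ[ℝ] V) ∘ₗ W.subtype)
      (fun c => by exact he c.2)).symm
  rw [h2]
  refine h1.trans (mul_le_mul ?_ ?_ (abs_nonneg _) (norm_nonneg _))
  · refine ContinuousLinearMap.opNorm_le_bound _ (norm_nonneg _) fun x => ?_
    have : (e.symm : V →L[ℝ] V) x = (M.symm : V →L[ℝ] V) (R'.symm x) := rfl
    rw [this]
    refine ((M.symm : V →L[ℝ] V).le_opNorm _).trans ?_
    rw [R'.symm.norm_map]
  · have h4 : ((e : V →L[ℝ] V) : V →ₗ[ℝ] V) = R.toLinearMap ∘ₗ ((M : V →L[ℝ] V) : V →ₗ[ℝ] V) := rfl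
    rw [h4, LinearMap.det_comp, abs_mul, ← LinearMap.normDet_eq_abs_det, R.normDet_eq_one, one_mul]

variable [MeasurableSpace V] [BorelSpace V]

open Module in
/-- The distortion of the area of subsets of a hyperplane under a linear automorphism. -/
theorem hausdorffMeasure_image_le_of_subset_hyperplane (M : V ≃L[ℝ] V) {W : Submodule ℝ V}
    (hW : finrank ℝ W + 1 = finrank ℝ V) {X : Set V} (hX : X ⊆ W) :
    Measure.hausdorffMeasure (finrank ℝ W) (M '' X) ≤
      ENNReal.ofReal (‖(M.symm : V →L[ℝ] V)‖ * |(M : V →L[ℝ] V).det|) *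
        Measure.hausdorffMeasure (finrank ℝ W) X := by
  obtain ⟨X', rfl⟩ : ∃ X' : Set W, X = Subtype.val '' X' :=
    ⟨Subtype.val ⁻¹' X, by
      ext x
      simpa using fun h => hX h⟩
  have h1 := LinearMap.hausdorffMeasure_image ((M : V →ₗ[ℝ] V) ∘ₗ W.subtype) X'
  have h2 : Measure.hausdorffMeasure (finrank ℝ W) (Subtype.val '' X' : Set V) =
      Measure.hausdorffMeasure (finrank ℝ W) X' :=
    isometry_subtype_coe.hausdorffMeasure_image (Or.inl (Nat.cast_nonneg _)) _
  rw [h2, image_image]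
  refine (le_of_eq h1).trans ?_
  gcongr
  exact M.normDet_comp_subtype_le hW

open Module in
-- Let P be the projection onto W. The linear and normal errors together make T⁻¹ ∘ P ∘ f differ
-- from the identity on A by an η-Lipschitz map, so it contracts distances by at most 1 - η. Its
-- image is T⁻¹ of a subset of W, where the hyperplane bound applies, and P does not increase area.
theorem ApproximatesLinearOn.hausdorffMeasure_le_of_almost_flat {f : V → V} {T : V ≃L[ℝ] V}
    {A : Set V} {δ : ℝ≥0} (hf : ApproximatesLinearOn f (T : V →L[ℝ] V) A δ) {W : Submodule ℝ V}
    (hW : finrank ℝ W + 1 = finrank ℝ V) {θ η : ℝ} (hθ0 : 0 ≤ θ)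
    (hθ : ∀ x ∈ A, ∀ y ∈ A,
      ‖(f x - f y) - W.starProjection (f x - f y)‖ ≤ θ * ‖f x - f y‖)
    (hη : ‖(T.symm : V →L[ℝ] V)‖ * (δ + θ * (‖(T : V →L[ℝ] V)‖ + δ)) ≤ η) (hη1 : η < 1) :
    Measure.hausdorffMeasure (finrank ℝ W) A ≤
      ENNReal.ofReal ((1 - η)⁻¹ ^ (finrank ℝ W)) *
      ENNReal.ofReal (‖(T : V →L[ℝ] V)‖ * |(T.symm : V →L[ℝ] V).det|) *
        Measure.hausdorffMeasure (finrank ℝ W) (f '' A) := by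
  set N := ‖(T.symm : V →L[ℝ] V)‖ with hN
  set P := W.starProjection with hP
  let φ : A → V := fun x => T.symm (P (f x))
  have h1η : 0 < 1 - η := by linarith
  have hkey : ∀ x y : A, (1 - η) * dist x y ≤ dist (φ x) (φ y) := by
    intro x y
    have hd : dist x y = ‖(x : V) - y‖ := by rw [Subtype.dist_eq, dist_eq_norm]
    have h1 := hf x x.2 y y.2
    rw [ContinuousLinearEquiv.coe_coe] at h1
    have h2 := hθ x x.2 y y.2
    have h3 : ‖f x - f y‖ ≤ (‖(T : V →L[ℝ] V)‖ + δ) * ‖(x : V) - y‖ := by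
      calc ‖f x - f y‖ = ‖(f x - f y - T (x - y)) + T (x - y)‖ := by simp
        _ ≤ ‖f x - f y - T (x - y)‖ + ‖T ((x : V) - y)‖ := norm_add_le _ _
        _ ≤ δ * ‖(x : V) - y‖ + ‖(T : V →L[ℝ] V)‖ * ‖(x : V) - y‖ := by
            gcongr
            exact (T : V →L[ℝ] V).le_opNorm _
        _ = _ := by ring
    have h4 : ((x : V) - y) - (φ x - φ y) = T.symm (-(f x - f y - T (x - y)) +
        ((f x - f y) - P (f x - f y))) := by
      apply T.injective
      simp only [φ, map_sub, map_add, map_neg, ContinuousLinearEquiv.apply_symm_apply]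
      abel
    have h5 : ‖((x : V) - y) - (φ x - φ y)‖ ≤ η * ‖(x : V) - y‖ := by
      rw [h4]
      refine ((T.symm : V →L[ℝ] V).le_opNorm _).trans ?_
      calc N * ‖-(f x - f y - T (x - y)) + ((f x - f y) - P (f x - f y))‖
          ≤ N * (δ * ‖(x : V) - y‖ + θ * ((‖(T : V →L[ℝ] V)‖ + δ) * ‖(x : V) - y‖)) := by
            gcongr
            refine (norm_add_le _ _).trans ?_
            rw [norm_neg]
            gcongr
            exact h2.trans (by gcongr)
        _ = N * (δ + θ * (‖(T : V →L[ℝ] V)‖ + δ)) * ‖(x : V) - y‖ := by ring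
        _ ≤ _ := by gcongr
    have h6 : ‖(x : V) - y‖ ≤ ‖((x : V) - y) - (φ x - φ y)‖ + ‖φ x - φ y‖ := by
      simpa using norm_add_le (((x : V) - y) - (φ x - φ y)) (φ x - φ y)
    rw [hd, dist_eq_norm]
    linarith
  have hanti : AntilipschitzWith (Real.toNNReal (1 - η)⁻¹) φ := by
    refine AntilipschitzWith.of_le_mul_dist fun x y => ?_
    rw [Real.coe_toNNReal _ (by positivity), inv_mul_eq_div, le_div_iff₀ h1η, mul_comm]
    exact hkey x y
  have hd0 : (0 : ℝ) ≤ (finrank ℝ W : ℝ) := Nat.cast_nonneg _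
  have s1 := hanti.le_hausdorffMeasure_image hd0 univ
  have s2 : Measure.hausdorffMeasure (finrank ℝ W : ℝ) (univ : Set A) =
      Measure.hausdorffMeasure (finrank ℝ W : ℝ) A := by
    rw [← isometry_subtype_coe.hausdorffMeasure_image (Or.inl hd0), image_univ,
      Subtype.range_coe]
  have s3 : φ '' univ = T.symm '' (P '' (f '' A)) := by
    rw [image_univ, image_image, image_image]
    ext z; simp [φ]
  have s4 := hausdorffMeasure_image_le_of_subset_hyperplane T.symm hW (X := P '' (f '' A))
    (by rintro _ ⟨z, -, rfl⟩; exact W.starProjection_apply_mem z)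
  have s5 := W.lipschitzWith_starProjection.hausdorffMeasure_image_le hd0 (f '' A)
  rw [s2, s3] at s1
  rw [ENNReal.coe_one, ENNReal.one_rpow, one_mul] at s5
  refine s1.trans ?_
  rw [mul_assoc]
  gcongr
  · rw [ENNReal.rpow_natCast, ENNReal.ofReal_pow (by positivity)]
    rfl
  · refine s4.trans ?_
    rw [ContinuousLinearEquiv.symm_symm]
    gcongr

end Hyperplane

/-! ### Preimages of spheres under almost linear maps -/

/-- Chords of a small piece of a sphere are almost orthogonal to its normal vectors. -/
theorem norm_sub_starProjection_chord_le {V : Type*} [NormedAddCommGroup V] [InnerProductSpace ℝ V]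
    {y₀ y y' z : V} {r ρ : ℝ} (hr : 0 < r) (hy : y ∈ Metric.sphere y₀ r)
    (hy' : y' ∈ Metric.sphere y₀ r) (hz : z ∈ Metric.sphere y₀ r) (hyz : dist z y ≤ ρ)
    (hyz' : dist z y' ≤ ρ) :
    ‖(y - y') - (ℝ ∙ (z - y₀))ᗮ.starProjection (y - y')‖ ≤ ρ / r * ‖y - y'‖ := by
  rw [mem_sphere_iff_norm] at hy hy' hz
  have h1 : (y - y') - (ℝ ∙ (z - y₀))ᗮ.starProjection (y - y') =
      (inner ℝ (z - y₀) (y - y') / r ^ 2) • (z - y₀) := by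
    rw [Submodule.starProjection_orthogonal_val, sub_sub_cancel, Submodule.starProjection_singleton,
      hz]
    rfl
  rw [h1, norm_smul, hz, Real.norm_eq_abs, abs_div, abs_of_pos (pow_pos hr 2)]
  -- The chord y - y' is orthogonal to (y - y₀) + (y' - y₀), and z - y₀ differs from half of that
  -- sum by a vector of norm at most ρ.
  have h2 : inner ℝ (z - y₀) (y - y') =
      inner ℝ ((1 / 2 : ℝ) • ((z - y) + (z - y'))) (y - y') := by
    have h3 : inner ℝ ((y - y₀) + (y' - y₀)) ((y - y₀) - (y' - y₀)) = 0 := by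
      rw [real_inner_add_sub_eq_zero_iff, hy, hy']
    have h4 : z - y₀ = (1 / 2 : ℝ) • ((z - y) + (z - y')) +
        (1 / 2 : ℝ) • ((y - y₀) + (y' - y₀)) := by module
    rw [sub_sub_sub_cancel_right] at h3
    conv_lhs => rw [h4]
    rw [inner_add_left, inner_smul_left _ _ (1 / 2 : ℝ), inner_smul_left _ _ (1 / 2 : ℝ), h3]
    simp
  have h5 : |inner ℝ (z - y₀) (y - y')| ≤ ρ * ‖y - y'‖ := by
    rw [h2]
    refine (abs_real_inner_le_norm _ _).trans ?_
    gcongr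
    rw [norm_smul, Real.norm_of_nonneg (by norm_num)]
    have := norm_add_le (z - y) (z - y')
    rw [← dist_eq_norm, ← dist_eq_norm] at this
    linarith
  calc |inner ℝ (z - y₀) (y - y')| / r ^ 2 * r = |inner ℝ (z - y₀) (y - y')| / r := by
        field_simp
    _ ≤ ρ * ‖y - y'‖ / r := by gcongr
    _ = _ := by ring

theorem exists_measurable_partition_of_dist_lt {X : Type*} [PseudoMetricSpace X] [MeasurableSpace X]
    [OpensMeasurableSpace X] [SecondCountableTopology X] [Nonempty X] {ρ : ℝ} (hρ : 0 < ρ) :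
    ∃ Y : ℕ → Set X, (∀ j, MeasurableSet (Y j)) ∧ Pairwise (Function.onFun Disjoint Y) ∧
      ⋃ j, Y j = univ ∧ ∀ j, ∀ x ∈ Y j, ∀ y ∈ Y j, dist x y < ρ := by
  refine ⟨disjointed fun j => Metric.ball (TopologicalSpace.denseSeq X j) (ρ / 2),
    fun j => MeasurableSet.disjointed (fun _ => measurableSet_ball) j, disjoint_disjointed _, ?_, ?_⟩
  · rw [iUnion_disjointed, eq_univ_iff_forall]
    intro x
    obtain ⟨_, h1, ⟨j, rfl⟩⟩ := Metric.dense_iff.1 (TopologicalSpace.denseRange_denseSeq X) x _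
      (half_pos hρ)
    exact mem_iUnion.2 ⟨j, by rw [Metric.mem_ball, dist_comm]; exact h1⟩
  · intro j x hx y hy
    have h1 := disjointed_subset _ _ hx
    have h2 := disjointed_subset _ _ hy
    rw [Metric.mem_ball] at h1 h2
    have := dist_triangle_right x y (TopologicalSpace.denseSeq X j)
    linarith

/-- Pieces of the sphere of diameter below θr are flat enough to be compared with a tangent
hyperplane. The resulting constant is the same for every piece, so the bounds add up over a
measurable partition. -/
theorem ApproximatesLinearOn.areaMeasure_inter_preimage_sphere_le {m : ℕ}
    {f : E (m + 1) → E (m + 1)} {T : E (m + 1) ≃L[ℝ] E (m + 1)} {A : Set (E (m + 1))} {δ : ℝ≥0}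
    (hf : ApproximatesLinearOn f (T : E (m + 1) →L[ℝ] E (m + 1)) A δ) {η : ℝ} (hη0 : 0 < η)
    (hη1 : η < 1) (hη : ‖(T.symm : E (m + 1) →L[ℝ] E (m + 1))‖ * δ ≤ η / 2) (y₀ : E (m + 1))
    {r : ℝ} (hr : 0 < r) :
    areaMeasure (m + 1) (A ∩ f ⁻¹' Metric.sphere y₀ r) ≤
      ENNReal.ofReal ((1 - η)⁻¹ ^ m) *
      ENNReal.ofReal (‖(T : E (m + 1) →L[ℝ] E (m + 1))‖ *
        |(T.symm : E (m + 1) →L[ℝ] E (m + 1)).det|) *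
      areaMeasure (m + 1) (Metric.sphere y₀ r ∩ f '' A) := by
  set N := ‖(T.symm : E (m + 1) →L[ℝ] E (m + 1))‖ with hN
  set τ := ‖(T : E (m + 1) →L[ℝ] E (m + 1))‖ with hτ
  have hN0 : 0 ≤ N := norm_nonneg _
  have hτ0 : 0 ≤ τ := norm_nonneg _
  -- The tolerance η is shared equally between the nonlinearity of f and the curvature of the
  -- sphere.
  set a := N * (τ + δ) with ha
  have ha0 : 0 ≤ a := by positivity
  set θ := η / 2 / (a + 1) with hθ
  have hθ0 : 0 < θ := by positivity
  have hθa : θ * a ≤ η / 2 := by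
    rw [hθ, div_mul_eq_mul_div, div_le_iff₀ (by positivity)]
    nlinarith
  have hbound : N * (δ + θ * (τ + δ)) ≤ η := by
    have : N * (δ + θ * (τ + δ)) = N * δ + θ * a := by rw [ha]; ring
    rw [this]; linarith
  obtain ⟨Y, hYm, hYd, hYu, hYρ⟩ := exists_measurable_partition_of_dist_lt (X := E (m + 1))
    (ρ := θ * r) (by positivity)
  set c := ENNReal.ofReal ((1 - η)⁻¹ ^ m) *
      ENNReal.ofReal (τ * |(T.symm : E (m + 1) →L[ℝ] E (m + 1)).det|) with hc
  let A' : ℕ → Set (E (m + 1)) := fun j => A ∩ f ⁻¹' (Metric.sphere y₀ r ∩ Y j)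
  have hpiece : ∀ j, areaMeasure (m + 1) (A' j) ≤ c * areaMeasure (m + 1) (f '' A' j) := by
    intro j
    rcases (A' j).eq_empty_or_nonempty with he | ⟨x, hx⟩
    · simp [he]
    · have hz : f x ∈ Metric.sphere y₀ r := hx.2.1
      have hne : f x - y₀ ≠ 0 := by
        rw [mem_sphere_iff_norm] at hz
        exact norm_pos_iff.1 (by rw [hz]; exact hr)
      set W := (ℝ ∙ (f x - y₀))ᗮ with hW
      have : Fact (Module.finrank ℝ (E (m + 1)) = m + 1) := ⟨finrank_euclideanSpace_fin⟩
      have hWm : Module.finrank ℝ W = m := Submodule.finrank_orthogonal_span_singleton hne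
      have key := (hf.mono_set (inter_subset_left (t := f ⁻¹' (Metric.sphere y₀ r ∩ Y j)))
        ).hausdorffMeasure_le_of_almost_flat (W := W) (by rw [hWm, finrank_euclideanSpace_fin])
        hθ0.le (by
          intro u hu v hv
          have := norm_sub_starProjection_chord_le hr hu.2.1 hv.2.1 hz
            (hYρ j _ hx.2.2 _ hu.2.2).le (hYρ j _ hx.2.2 _ hv.2.2).le
          rwa [mul_div_assoc, div_self hr.ne', mul_one] at this) hbound hη1
      rw [hWm] at key
      rw [areaMeasure_succ]
      exact key
  have hU : A ∩ f ⁻¹' Metric.sphere y₀ r = ⋃ j, A' j := by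
    simp only [A', ← inter_iUnion, ← preimage_iUnion, hYu, inter_univ]
  calc areaMeasure (m + 1) (A ∩ f ⁻¹' Metric.sphere y₀ r)
      ≤ ∑' j, areaMeasure (m + 1) (A' j) := by rw [hU]; exact measure_iUnion_le _
    _ ≤ ∑' j, c * areaMeasure (m + 1) (Y j ∩ (Metric.sphere y₀ r ∩ f '' A)) := by
        refine ENNReal.tsum_le_tsum fun j => (hpiece j).trans ?_
        gcongr
        rintro _ ⟨x, hx, rfl⟩
        exact ⟨hx.2.2, hx.2.1, x, hx.1, rfl⟩
    _ = c * areaMeasure (m + 1) (Metric.sphere y₀ r ∩ f '' A) := by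
        rw [ENNReal.tsum_mul_left]
        congr 1
        simp_rw [← Measure.restrict_apply (hYm _)]
        rw [← measure_iUnion hYd hYm, hYu, Measure.restrict_apply_univ]

/-- The quotient ‖A‖/|det A| is continuous and positive at an invertible T. -/
theorem ContinuousLinearMap.exists_stable_radius {V : Type*} [NormedAddCommGroup V]
    [NormedSpace ℝ V] [FiniteDimensional ℝ V] [Nontrivial V] (T : V ≃L[ℝ] V) {κ η : ℝ} (hκ : 1 < κ)
    (hη : 0 < η) :
    ∃ δ : ℝ≥0, δ ≠ 0 ∧ ‖(T.symm : V →L[ℝ] V)‖ * δ ≤ η ∧ ∀ A : V →L[ℝ] V,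
      ‖A - (T : V →L[ℝ] V)‖ ≤ δ →
        ‖(T : V →L[ℝ] V)‖ / |(T : V →L[ℝ] V).det| ≤ κ * (‖A‖ / |A.det|) := by
  have hdet : |(T : V →L[ℝ] V).det| ≠ 0 := by
    rw [abs_ne_zero]
    exact (LinearEquiv.isUnit_det' T.toLinearEquiv).ne_zero
  have hT : 0 < ‖(T : V →L[ℝ] V)‖ := norm_pos_iff.2 fun h => by
    obtain ⟨v, hv⟩ := exists_ne (0 : V)
    exact hv (T.injective (by simpa using congrArg (fun L : V →L[ℝ] V => L v) h))
  set v := ‖(T : V →L[ℝ] V)‖ / |(T : V →L[ℝ] V).det| with hv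
  have hv0 : 0 < v := by positivity
  have hcont : ContinuousAt (fun A : V →L[ℝ] V => ‖A‖ / |A.det|) (T : V →L[ℝ] V) :=
    continuous_norm.continuousAt.div ContinuousLinearMap.continuous_det.abs.continuousAt hdet
  have hlt : v / κ < v := div_lt_self hv0 hκ
  obtain ⟨ε, hε, hball⟩ := Metric.eventually_nhds_iff.1 (hcont.eventually_const_lt hlt)
  set N := ‖(T.symm : V →L[ℝ] V)‖
  have hN : 0 ≤ N := norm_nonneg _
  refine ⟨⟨min (ε / 2) (η / (N + 1)), by positivity⟩, ?_, ?_, fun A hA => ?_⟩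
  · have : 0 < min (ε / 2) (η / (N + 1)) := by positivity
    exact fun h => this.ne' (congrArg NNReal.toReal h)
  · calc N * min (ε / 2) (η / (N + 1)) ≤ N * (η / (N + 1)) := by gcongr; exact min_le_right _ _
      _ ≤ η := by
        rw [mul_div_assoc', div_le_iff₀ (by positivity)]
        nlinarith
  · have h1 : ‖A - (T : V →L[ℝ] V)‖ < ε := by
      refine hA.trans_lt ?_
      have : min (ε / 2) (η / (N + 1)) < ε := (min_le_left _ _).trans_lt (half_lt_self hε)
      exact this
    rw [← dist_eq_norm] at h1
    have h2 := hball h1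
    rw [div_lt_iff₀ (by linarith)] at h2
    linarith

theorem exists_inv_one_sub_pow_le (m : ℕ) {κ : ℝ} (hκ : 1 < κ) :
    ∃ η : ℝ, 0 < η ∧ η < 1 ∧ (1 - η)⁻¹ ^ m ≤ κ := by
  have hc : ContinuousAt (fun η : ℝ => (1 - η)⁻¹ ^ m) 0 := by
    have : (1 : ℝ) - 0 ≠ 0 := by norm_num
    fun_prop (disch := assumption)
  have h1 : ∀ᶠ η in 𝓝[>] (0 : ℝ), (1 - η)⁻¹ ^ m < κ :=
    (hc.eventually_lt_const (by simpa using hκ)).filter_mono nhdsWithin_le_nhds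
  obtain ⟨η, h2, h3⟩ := (h1.and (Ioo_mem_nhdsGT zero_lt_one)).exists
  exact ⟨η, h3.1, h3.2, h2.le⟩

/-! ### Decomposition of the domain into regular pieces -/

/-- Points where `f` is differentiable with invertible derivative. -/
def regularPoints {n : ℕ} (f : E n → E n) (D : Set (E n)) : Set (E n) :=
  {x | x ∈ D ∧ DifferentiableAt ℝ f x ∧ jacobian f x ≠ 0}

theorem measurable_jacobian {n : ℕ} (f : E n → E n) : Measurable (jacobian f) :=
  ContinuousLinearMap.continuous_det.measurable.comp (measurable_fderiv ℝ f)

theorem measurableSet_regularPoints {n : ℕ} (f : E n → E n) {D : Set (E n)}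
    (hD : MeasurableSet D) : MeasurableSet (regularPoints f D) :=
  hD.inter ((measurableSet_of_differentiableAt ℝ f).inter
    (measurable_jacobian f (measurableSet_singleton 0).compl))

/-- The image of the critical set is null by Sard's argument, so the critical set itself is null by
the N⁻¹-property. -/
theorem volume_diff_regularPoints {n : ℕ} {f : E n → E n} {D : Set (E n)} (hD : MeasurableSet D)
    (hdiff : ∀ᵐ x ∂(volume.restrict D), DifferentiableAt ℝ f x) (hNinv : LuzinNInv f D) :
    volume (D \ regularPoints f D) = 0 := by
  have h1 : volume {x | x ∈ D ∧ ¬ DifferentiableAt ℝ f x} = 0 := by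
    rw [ae_restrict_iff' hD, ae_iff] at hdiff
    refine measure_mono_null ?_ hdiff
    rintro x ⟨hx, hx'⟩ h
    exact hx' (h hx)
  have h2 : volume (f '' {x | x ∈ D ∧ DifferentiableAt ℝ f x ∧ jacobian f x = 0}) = 0 :=
    addHaar_image_eq_zero_of_det_fderivWithin_eq_zero volume
      (f' := fderiv ℝ f) (fun x hx => hx.2.1.hasFDerivAt.hasFDerivWithinAt) (fun x hx => hx.2.2)
  refine measure_mono_null ?_ (measure_union_null h1 (hNinv _ h2))
  rintro x ⟨hxD, hx⟩
  by_cases hd : DifferentiableAt ℝ f x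
  · right
    refine ⟨hxD, x, ⟨hxD, hd, ?_⟩, rfl⟩
    by_contra hJ
    exact hx ⟨hxD, hd, hJ⟩
  · exact Or.inl ⟨hxD, hd⟩

/-- A piece of the domain on which `f` is injective and almost linear, so that it distorts the area
of preimages of spheres by a factor of at most `c`, where `c` is almost optimal. -/
structure IsRegularPiece {m : ℕ} (f : E (m + 1) → E (m + 1)) (D : Set (E (m + 1))) (κ : ℝ)
    (B : Set (E (m + 1))) (c : ℝ≥0∞) : Prop where
  measurableSet : MeasurableSet B
  subset : B ⊆ regularPoints f D
  injOn : InjOn f B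
  le : ∀ x ∈ B, c ≤ ENNReal.ofReal (κ * (‖fderiv ℝ f x‖ / |jacobian f x|))
  area_le : ∀ A ⊆ B, ∀ (y₀ : E (m + 1)) (r : ℝ), 0 < r →
    areaMeasure (m + 1) (A ∩ f ⁻¹' Metric.sphere y₀ r) ≤
      c * areaMeasure (m + 1) (Metric.sphere y₀ r ∩ f '' A)

/-- One factor κ absorbs the error (1 - η)⁻ᵐ of the area estimate; the other pays for replacing the
linear model of a piece by the derivative at each of its points. -/
theorem exists_regularPieces {m : ℕ} {f : E (m + 1) → E (m + 1)} {D : Set (E (m + 1))}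
    (hD : MeasurableSet D) {κ : ℝ} (hκ : 1 < κ) :
    ∃ (B : ℕ → Set (E (m + 1))) (c : ℕ → ℝ≥0∞), (∀ k, IsRegularPiece f D (κ * κ) (B k) (c k)) ∧
      Pairwise (Function.onFun Disjoint B) ∧ volume (regularPoints f D \ ⋃ k, B k) = 0 := by
  classical
  set G := regularPoints f D with hG
  have hGm : MeasurableSet G := measurableSet_regularPoints f hD
  rcases G.eq_empty_or_nonempty with hGe | hGne
  · refine ⟨fun _ => ∅, fun _ => 0, fun k => ⟨MeasurableSet.empty, empty_subset _, injOn_empty _,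
      by simp, fun A hA => ?_⟩, fun _ _ _ => by simp, by simp [hGe]⟩
    rw [subset_empty_iff.1 hA]
    simp
  obtain ⟨η, hη0, hη1, hηκ⟩ := exists_inv_one_sub_pow_le m hκ
  choose δ hδ0 hδη hδκ using fun T : E (m + 1) ≃L[ℝ] E (m + 1) =>
    ContinuousLinearMap.exists_stable_radius T hκ (half_pos hη0)
  let ρ : (E (m + 1) →L[ℝ] E (m + 1)) → ℝ≥0 := fun A =>
    if h : A.det ≠ 0 then δ (A.toContinuousLinearEquivOfDetNeZero h) else 1
  have hρ0 : ∀ A, ρ A ≠ 0 := by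
    intro A
    simp only [ρ]
    split_ifs
    · exact hδ0 _
    · exact one_ne_zero
  obtain ⟨t, A, htd, htm, htG, htA, hA⟩ :=
    exists_partition_approximatesLinearOn_of_hasFDerivWithinAt f G (fderiv ℝ f)
      (fun x hx => hx.2.1.hasFDerivAt.hasFDerivWithinAt) ρ hρ0
  have hdet : ∀ k, (A k).det ≠ 0 := by
    intro k
    obtain ⟨y, hy, hAy⟩ := hA hGne k
    rw [hAy]
    exact hy.2.2
  let T : ℕ → E (m + 1) ≃L[ℝ] E (m + 1) := fun k =>
    (A k).toContinuousLinearEquivOfDetNeZero (hdet k)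
  have hTA : ∀ k, (T k : E (m + 1) →L[ℝ] E (m + 1)) = A k := fun k =>
    ContinuousLinearMap.coe_toContinuousLinearEquivOfDetNeZero _ _
  have hρ : ∀ k, ρ (A k) = δ (T k) := fun k => by simp [ρ, hdet k, T]
  -- Linear approximation on t k forces the derivative to be δ-close to A k only almost everywhere;
  -- the other points are discarded.
  let S : ℕ → Set (E (m + 1)) := fun k => {x | ‖fderiv ℝ f x - A k‖ ≤ δ (T k)}
  have hSm : ∀ k, MeasurableSet (S k) := fun k =>
    measurableSet_le ((measurable_fderiv ℝ f).sub_const _).norm measurable_const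
  let B : ℕ → Set (E (m + 1)) := fun k => G ∩ t k ∩ S k
  have happ : ∀ k, ApproximatesLinearOn f (T k : E (m + 1) →L[ℝ] E (m + 1)) (B k) (δ (T k)) := by
    intro k
    rw [hTA, ← hρ]
    exact (htA k).mono_set inter_subset_left
  let c : ℕ → ℝ≥0∞ := fun k => ENNReal.ofReal ((1 - η)⁻¹ ^ m) *
      ENNReal.ofReal (‖(T k : E (m + 1) →L[ℝ] E (m + 1))‖ *
        |((T k).symm : E (m + 1) →L[ℝ] E (m + 1)).det|)
  refine ⟨B, c, fun k => ⟨(hGm.inter (htm k)).inter (hSm k),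
    inter_subset_left.trans inter_subset_left, ?_, ?_, ?_⟩, ?_, ?_⟩
  · refine (happ k).injOn (Or.inr ?_)
    rw [← NNReal.coe_lt_coe, NNReal.coe_inv]
    have h1 := hδη (T k)
    have h2 : (0 : ℝ) < ‖((T k).symm : E (m + 1) →L[ℝ] E (m + 1))‖₊ := (T k).nnnorm_symm_pos
    rw [← one_div, lt_div_iff₀ h2, coe_nnnorm, mul_comm]
    linarith
  · intro x hx
    have h1 : ‖fderiv ℝ f x - (T k : E (m + 1) →L[ℝ] E (m + 1))‖ ≤ δ (T k) := by
      rw [hTA]; exact hx.2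
    have h2 := hδκ (T k) _ h1
    have h3 : |((T k).symm : E (m + 1) →L[ℝ] E (m + 1)).det| =
        |(T k : E (m + 1) →L[ℝ] E (m + 1)).det|⁻¹ := by
      rw [← abs_inv]
      congr 1
      exact (T k).det_coe_symm
    have h1η : 0 < 1 - η := by linarith
    simp only [c]
    rw [h3, ← ENNReal.ofReal_mul (by positivity), ← div_eq_mul_inv]
    refine ENNReal.ofReal_le_ofReal ?_
    rw [mul_assoc]
    exact mul_le_mul hηκ h2 (by positivity) (by linarith)
  · intro A' hA' y₀ r hr
    exact ((happ k).mono_set hA').areaMeasure_inter_preimage_sphere_le hη0 hη1 (hδη (T k)) y₀ hr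
  · intro i j hij
    exact (htd hij).mono (inter_subset_left.trans inter_subset_right)
      (inter_subset_left.trans inter_subset_right)
  · have hnull : ∀ k, volume ((G ∩ t k) \ S k) = 0 := by
      intro k
      have h1 := (htA k).norm_fderiv_sub_le volume (hGm.inter (htm k)) (fderiv ℝ f)
        (fun x hx => hx.1.2.1.hasFDerivAt.hasFDerivWithinAt)
      rw [ae_restrict_iff' (hGm.inter (htm k)), ae_iff] at h1
      refine measure_mono_null ?_ h1
      rintro x ⟨hx, hxS⟩ h
      have := h hx
      rw [hρ] at this
      exact hxS (by exact_mod_cast this)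
    refine measure_mono_null ?_ (measure_iUnion_null hnull)
    rintro x ⟨hxG, hxB⟩
    obtain ⟨k, hk⟩ := mem_iUnion.1 (htG hxG)
    refine mem_iUnion.2 ⟨k, ⟨hxG, hk⟩, fun hS => hxB (mem_iUnion.2 ⟨k, ⟨hxG, hk⟩, hS⟩)⟩

/-! ### Pushing functions forward along injective pieces -/

section Transport

variable {X Y : Type*}

/-- The function `g ∘ (f|B)⁻¹` on `f(B)`, extended by zero. -/
noncomputable def transport (f : X → Y) (B : Set X) (g : X → ℝ≥0∞) : Y → ℝ≥0∞ :=
  Function.extend (B.domRestrict f) (fun x => g x) 0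

theorem transport_apply {f : X → Y} {B : Set X} (hf : InjOn f B) (g : X → ℝ≥0∞) {x : X}
    (hx : x ∈ B) : transport f B g (f x) = g x :=
  (injOn_iff_injective.1 hf).extend_apply (fun x : B => g x) 0 ⟨x, hx⟩

theorem transport_of_notMem {f : X → Y} {B : Set X} (g : X → ℝ≥0∞) {y : Y} (hy : y ∉ f '' B) :
    transport f B g y = 0 :=
  Function.extend_apply' _ _ _ (by rintro ⟨x, rfl⟩; exact hy ⟨x, x.2, rfl⟩)

theorem support_transport_subset {f : X → Y} {B : Set X} (g : X → ℝ≥0∞) :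
    Function.support (transport f B g) ⊆ f '' B := by
  intro y hy
  by_contra h
  exact hy (transport_of_notMem g h)

theorem measurable_transport [MeasurableSpace X] [MeasurableSpace Y] {f : X → Y} {B : Set X}
    (hf : MeasurableEmbedding (B.domRestrict f)) {g : X → ℝ≥0∞} (hg : Measurable g) :
    Measurable (transport f B g) :=
  hf.measurable_extend (hg.comp measurable_subtype_coe) measurable_const

/-- An upper bound for a measure on `B` by the pullback of a measure under `f` gives the
corresponding bound for integrals. -/
theorem lintegral_restrict_le_mul_lintegral_transport [MeasurableSpace X] [MeasurableSpace Y]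
    {f : X → Y} {B : Set X} (hB : MeasurableSet B) (hf : MeasurableEmbedding (B.domRestrict f))
    {μ : Measure X} {ν : Measure Y} {c : ℝ≥0∞} {S : Set X}
    (h : ∀ A ⊆ B, MeasurableSet A → μ (A ∩ S) ≤ c * ν (f '' A)) {g : X → ℝ≥0∞}
    (hg : Measurable g) :
    ∫⁻ x in B ∩ S, g x ∂μ ≤ c * ∫⁻ y, transport f B g y ∂ν := by
  have hinj : InjOn f B := injOn_iff_injective.2 hf.injective
  -- The set inequality says that μ on B ∩ S is dominated by c times ν pulled back through f|B.
  have hle : μ.restrict (B ∩ S) ≤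
      c • ((ν.comap (B.domRestrict f)).map (Subtype.val : B → X)) := by
    refine Measure.le_iff.2 fun A hA => ?_
    rw [Measure.restrict_apply hA, Measure.smul_apply, smul_eq_mul,
      Measure.map_apply measurable_subtype_coe hA, hf.comap_apply]
    have h1 : B.domRestrict f '' (Subtype.val ⁻¹' A) = f '' (A ∩ B) := by
      ext y
      constructor
      · rintro ⟨x, hx, rfl⟩; exact ⟨x, ⟨hx, x.2⟩, rfl⟩
      · rintro ⟨x, ⟨hx, hxB⟩, rfl⟩; exact ⟨⟨x, hxB⟩, hx, rfl⟩
    rw [h1, ← inter_assoc]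
    exact h _ inter_subset_right (hA.inter hB)
  calc ∫⁻ x in B ∩ S, g x ∂μ
      ≤ ∫⁻ x, g x ∂(c • ((ν.comap (B.domRestrict f)).map (Subtype.val : B → X))) :=
        lintegral_mono' hle le_rfl
    _ = c * ∫⁻ x : B, transport f B g (B.domRestrict f x) ∂(ν.comap (B.domRestrict f)) := by
        rw [lintegral_smul_measure, lintegral_map hg measurable_subtype_coe, smul_eq_mul]
        congr 1
        exact lintegral_congr fun x => (transport_apply hinj g x.2).symm
    _ = c * ∫⁻ y in range (B.domRestrict f), transport f B g y ∂ν := by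
        rw [← hf.lintegral_map, hf.map_comap]
    _ ≤ _ := by gcongr; exact Measure.restrict_le_self

end Transport

theorem IsRegularPiece.measurableEmbedding {m : ℕ} {f : E (m + 1) → E (m + 1)}
    {D : Set (E (m + 1))} {κ : ℝ} {B : Set (E (m + 1))} {c : ℝ≥0∞} (h : IsRegularPiece f D κ B c) :
    MeasurableEmbedding (B.domRestrict f) :=
  ContinuousOn.measurableEmbedding h.measurableSet
    (fun _ hx => (h.subset hx).2.1.continuousAt.continuousWithinAt) h.injOn

theorem IsRegularPiece.lintegral_le {m : ℕ} {f : E (m + 1) → E (m + 1)}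
    {D : Set (E (m + 1))} {κ : ℝ} {B : Set (E (m + 1))} {c : ℝ≥0∞} (h : IsRegularPiece f D κ B c)
    (y₀ : E (m + 1)) {r : ℝ} (hr : 0 < r) {g : E (m + 1) → ℝ≥0∞} (hg : Measurable g) :
    ∫⁻ x in B ∩ f ⁻¹' Metric.sphere y₀ r, g x ∂(areaMeasure (m + 1)) ≤
      c * ∫⁻ y in Metric.sphere y₀ r ∩ f '' D, transport f B g y ∂(areaMeasure (m + 1)) := by
  refine lintegral_restrict_le_mul_lintegral_transport h.measurableSet h.measurableEmbedding
    (fun A hAB hA => ?_) hg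
  have hfA : MeasurableSet (f '' A) := by
    have : f '' A = B.domRestrict f '' (Subtype.val ⁻¹' A) := by
      ext y
      constructor
      · rintro ⟨x, hx, rfl⟩; exact ⟨⟨x, hAB hx⟩, hx, rfl⟩
      · rintro ⟨x, hx, rfl⟩; exact ⟨x, hx, rfl⟩
    rw [this]
    exact h.measurableEmbedding.measurableSet_image.2 (measurable_subtype_coe hA)
  rw [Measure.restrict_apply hfA]
  refine (h.area_le A hAB y₀ r hr).trans ?_
  gcongr c * ?_
  refine measure_mono ?_
  rintro y ⟨hy, x, hx, rfl⟩
  exact ⟨⟨x, hx, rfl⟩, hy, x, (h.subset (hAB hx)).1, rfl⟩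

theorem IsRegularPiece.lintegral_transport_div_jacobian {m : ℕ} {f : E (m + 1) → E (m + 1)}
    {D : Set (E (m + 1))} {κ : ℝ} {B : Set (E (m + 1))} {c : ℝ≥0∞} (h : IsRegularPiece f D κ B c)
    (g : E (m + 1) → ℝ≥0∞) :
    ∫⁻ y, transport f B (fun x => g x / ENNReal.ofReal |jacobian f x|) y = ∫⁻ x in B, g x := by
  rw [← setLIntegral_eq_of_support_subset (support_transport_subset _),
    lintegral_image_eq_lintegral_abs_det_fderiv_mul volume h.measurableSet
      (fun x hx => (h.subset hx).2.1.hasFDerivAt.hasFDerivWithinAt) h.injOn]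
  refine setLIntegral_congr_fun h.measurableSet fun x hx => ?_
  rw [transport_apply h.injOn _ hx]
  have hJ : ENNReal.ofReal |jacobian f x| ≠ 0 := by
    rw [Ne, ENNReal.ofReal_eq_zero, not_le]
    exact abs_pos.2 (h.subset hx).2.2
  exact ENNReal.mul_div_cancel hJ ENNReal.ofReal_ne_top

/-! ### Hölder's inequality over the fibres -/

theorem ENNReal.tsum_mul_le_Lp_mul_Lq {p q : ℝ} (hpq : p.HolderConjugate q) (a b : ℕ → ℝ≥0∞) :
    ∑' k, a k * b k ≤ (∑' k, a k ^ p) ^ (1 / p) * (∑' k, b k ^ q) ^ (1 / q) := by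
  have := ENNReal.lintegral_mul_le_Lp_mul_Lq (Measure.count : Measure ℕ) hpq (f := a) (g := b)
    (measurable_of_countable _).aemeasurable (measurable_of_countable _).aemeasurable
  simpa only [lintegral_count, Pi.mul_apply] using this

/-- Distinct pieces contribute distinct points of the fibre, which may also contain points outside
all pieces. -/
theorem tsum_transport_le {X Y : Type*} {f : X → Y} {D : Set X} {B : ℕ → Set X}
    (hBD : ∀ k, B k ⊆ D) (hB : ∀ k, InjOn f (B k)) (hd : Pairwise (Function.onFun Disjoint B))
    (g : X → ℝ≥0∞) (y : Y) :
    ∑' k, transport f (B k) g y ≤ ∑' x : {x : X // x ∈ D ∧ f x = y}, g x := by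
  have hsupp : Function.support (fun k => transport f (B k) g y) ⊆ {k | y ∈ f '' B k} :=
    fun k hk => support_transport_subset g hk
  rw [← tsum_subtype_eq_of_support_subset hsupp]
  have hex : ∀ k : {k | y ∈ f '' B k}, ∃ x, x ∈ B k ∧ f x = y := fun k => k.2
  choose x hxB hxy using hex
  let φ : {k | y ∈ f '' B k} → {x : X // x ∈ D ∧ f x = y} := fun k =>
    ⟨x k, hBD _ (hxB k), hxy k⟩
  have hφ : Function.Injective φ := by
    intro i j hij
    have h1 : x i = x j := congrArg Subtype.val hij
    by_contra hne
    exact Set.disjoint_left.1 (hd fun h => hne (Subtype.ext h)) (hxB i) (h1 ▸ hxB j)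
  calc ∑' k : {k | y ∈ f '' B k}, transport f (B k) g y
      = ∑' k : {k | y ∈ f '' B k}, g (φ k : X) := by
        refine tsum_congr fun k => ?_
        rw [← transport_apply (hB k) g (hxB k), hxy k]
    _ ≤ _ := ENNReal.tsum_comp_le_tsum_of_injective hφ (fun x : {x : X // x ∈ D ∧ f x = y} => g x)

/-- The pointwise Hölder inequality behind the modulus estimate. -/
theorem rpow_tsum_transport_le {m : ℕ} (hm : 0 < m) {f : E (m + 1) → E (m + 1)}
    {D : Set (E (m + 1))} {κ : ℝ} (hκ : 0 ≤ κ) {B : ℕ → Set (E (m + 1))} {c : ℕ → ℝ≥0∞}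
    (h : ∀ k, IsRegularPiece f D κ (B k) (c k)) (hd : Pairwise (Function.onFun Disjoint B))
    {p : ℝ} (hp : (m : ℝ) < p) (g : E (m + 1) → ℝ≥0∞) (y : E (m + 1)) :
    (∑' k, c k * transport f (B k) g y) ^ (p / m) ≤
      ENNReal.ofReal κ ^ (p / m) *
        (∑' k, transport f (B k) (fun x => g x ^ (p / m) / ENNReal.ofReal |jacobian f x|) y) *
        inverseDilatation (p / (p - m)) f D y ^ ((p - m) / m) := by
  have hm0 : (0 : ℝ) < m := by exact_mod_cast hm
  have hp0 : 0 < p := hm0.trans hp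
  have hpm : 0 < p - m := by linarith
  set q := p / m with hq
  set α := p / (p - m) with hα
  have hq0 : 0 < q := by positivity
  have hα0 : 0 < α := by positivity
  have hq1 : 1 < q := by rwa [hq, one_lt_div hm0]
  have hconj : q.HolderConjugate α := by
    rw [Real.holderConjugate_iff]
    refine ⟨hq1, ?_⟩
    rw [hq, hα]
    field_simp
    ring
  set w : E (m + 1) → ℝ≥0∞ := fun x => g x ^ q / ENNReal.ofReal |jacobian f x| with hw
  let a : ℕ → ℝ≥0∞ := fun k => transport f (B k) w y ^ (1 / q)
  let b : ℕ → ℝ≥0∞ := fun k => transport f (B k) (outerDilatation α f) y ^ (1 / α)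
  -- Since 1/q + 1/α = 1, the factor ‖f'‖/|J| splits as |J|^(-1/q) times (‖f'‖^α/|J|)^(1/α).
  have hterm : ∀ k, c k * transport f (B k) g y ≤ ENNReal.ofReal κ * (a k * b k) := by
    intro k
    by_cases hy : y ∈ f '' B k
    · obtain ⟨x, hx, rfl⟩ := hy
      have hJ := ((h k).subset hx).2.2
      have hJ0 : 0 < |jacobian f x| := abs_pos.2 hJ
      simp only [a, b]
      rw [transport_apply (h k).injOn _ hx, transport_apply (h k).injOn _ hx,
        transport_apply (h k).injOn _ hx]
      have hL : outerDilatation α f x =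
          ENNReal.ofReal (‖fderiv ℝ f x‖ ^ α / |jacobian f x|) := if_pos hJ
      set L := ‖fderiv ℝ f x‖
      set J := |jacobian f x|
      have hL0 : 0 ≤ L := norm_nonneg _
      have h1 : (w x) ^ (1 / q) = g x * ENNReal.ofReal (J ^ (-(1 / q))) := by
        simp only [hw]
        rw [ENNReal.div_rpow_of_nonneg _ _ (by positivity), ← ENNReal.rpow_mul,
          mul_one_div_cancel hq0.ne', ENNReal.rpow_one, Real.rpow_neg hJ0.le,
          ENNReal.ofReal_inv_of_pos (by positivity), ENNReal.ofReal_rpow_of_pos hJ0, div_eq_mul_inv]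
      have h2 : outerDilatation α f x ^ (1 / α) = ENNReal.ofReal (L * J ^ (-(1 / α))) := by
        rw [hL, ENNReal.ofReal_rpow_of_nonneg (by positivity) (by positivity),
          Real.div_rpow (by positivity) hJ0.le, ← Real.rpow_mul hL0, mul_one_div_cancel hα0.ne',
          Real.rpow_one, Real.rpow_neg hJ0.le, div_eq_mul_inv]
      have h3 : J ^ (-(1 / q)) * (L * J ^ (-(1 / α))) = L / J := by
        rw [mul_left_comm, ← Real.rpow_add hJ0]
        have : -(1 / q) + -(1 / α) = -1 := by
          have := hconj.inv_add_inv_eq_one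
          rw [one_div, one_div]; linarith
        rw [this, Real.rpow_neg_one, div_eq_mul_inv]
      rw [h1, h2, mul_assoc, ← ENNReal.ofReal_mul (by positivity), h3, mul_left_comm, mul_comm,
        ← ENNReal.ofReal_mul hκ]
      gcongr
      exact (h k).le x hx
    · rw [transport_of_notMem g hy, mul_zero]
      exact zero_le
  have hA : ∀ k, a k ^ q = transport f (B k) w y := fun k => by
    simp only [a]
    rw [← ENNReal.rpow_mul, one_div_mul_cancel hq0.ne', ENNReal.rpow_one]
  have hB : ∀ k, b k ^ α = transport f (B k) (outerDilatation α f) y := fun k => by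
    simp only [b]
    rw [← ENNReal.rpow_mul, one_div_mul_cancel hα0.ne', ENNReal.rpow_one]
  have hQ : ∑' k, b k ^ α ≤ inverseDilatation α f D y := by
    simp_rw [hB]
    exact tsum_transport_le (fun k => (h k).subset.trans fun x hx => hx.1) (fun k => (h k).injOn)
      hd _ y
  calc (∑' k, c k * transport f (B k) g y) ^ q
      ≤ (ENNReal.ofReal κ * ((∑' k, a k ^ q) ^ (1 / q) * (∑' k, b k ^ α) ^ (1 / α))) ^ q := by
        gcongr
        refine (ENNReal.tsum_le_tsum hterm).trans ?_
        rw [ENNReal.tsum_mul_left]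
        gcongr
        exact ENNReal.tsum_mul_le_Lp_mul_Lq hconj a b
    _ = ENNReal.ofReal κ ^ q * (∑' k, transport f (B k) w y) *
          (∑' k, b k ^ α) ^ ((p - m) / m) := by
        rw [ENNReal.mul_rpow_of_nonneg _ _ hq0.le, ENNReal.mul_rpow_of_nonneg _ _ hq0.le,
          ← ENNReal.rpow_mul, ← ENNReal.rpow_mul, one_div_mul_cancel hq0.ne', ENNReal.rpow_one,
          mul_assoc]
        have hexp : 1 / α * q = (p - m) / m := by
          rw [hq, hα]
          field_simp
        rw [hexp]
        simp_rw [hA]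
    _ ≤ _ := by gcongr

/-! ### Exceptional radii and the modulus estimate -/

theorem measurableSet_radii (ε : ℝ) (R : ℝ≥0∞) : MeasurableSet (radii ε R) :=
  measurableSet_Ioi.inter (ENNReal.measurable_ofReal measurableSet_Iio)

theorem imageFamily_preimageSpheres {n : ℕ} (f : E n → E n) (D : Set (E n)) (y₀ : E n) (ε : ℝ) :
    imageFamily f (preimageSpheres f D y₀ ε) =
      (fun r => Metric.sphere y₀ r ∩ f '' D) '' radii ε (outerRadius f D y₀) := by
  have h : ∀ r, f '' (D ∩ f ⁻¹' (Metric.sphere y₀ r ∩ f '' D)) = Metric.sphere y₀ r ∩ f '' D := by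
    intro r
    rw [image_inter_preimage, inter_comm, inter_assoc, inter_self]
  ext S
  constructor
  · rintro ⟨_, ⟨r, hr, rfl⟩, rfl⟩
    exact ⟨r, hr, (h r).symm⟩
  · rintro ⟨r, hr, rfl⟩
    exact ⟨_, ⟨r, hr, rfl⟩, h r⟩

theorem exists_dist_lt_of_mem_radii {n : ℕ} {f : E n → E n} {D : Set (E n)} {y₀ : E n}
    (hy₀ : y₀ ∈ closure (f '' D)) {ε : ℝ} (hε : 0 < ε) {r : ℝ}
    (hr : r ∈ radii ε (outerRadius f D y₀)) :
    (∃ x ∈ D, dist (f x) y₀ < r) ∧ ∃ x ∈ D, r < dist (f x) y₀ := by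
  constructor
  · obtain ⟨_, ⟨x, hx, rfl⟩, h⟩ := Metric.mem_closure_iff.1 hy₀ ε hε
    exact ⟨x, hx, by rw [dist_comm]; exact h.trans hr.1⟩
  · have h := hr.2
    simp only [outerRadius, lt_iSup_iff] at h
    obtain ⟨_, ⟨x, hx, rfl⟩, h⟩ := h
    refine ⟨x, hx, ?_⟩
    rw [edist_dist] at h
    exact (ENNReal.ofReal_lt_ofReal_iff_of_nonneg (hε.le.trans hr.1.le)).1 h

theorem finite_fibre_of_maxMultiplicity_ne_top {n : ℕ} {f : E n → E n} {D : Set (E n)}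
    (h : maxMultiplicity f D ≠ ⊤) (y : E n) : {x | x ∈ D ∧ f x = y}.Finite := by
  rw [← Set.encard_lt_top_iff]
  exact (le_iSup (fun y => multiplicityAt f D y) y).trans_lt (lt_top_iff_ne_top.2 h)

/-- A null set of radii gives an exceptional family of pieces of spheres, provided that these
pieces have positive area. -/
theorem modulus_spheres_eq_zero {m : ℕ} (hm : 0 < m) {p : ℝ} (hp : 0 < p) (y₀ : E (m + 1))
    (Y : Set (E (m + 1))) {R : Set ℝ} (hR : volume R = 0)
    (hpos : ∀ r ∈ R, areaMeasure (m + 1) (Metric.sphere y₀ r ∩ Y) ≠ 0) :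
    modulus p ((fun r => Metric.sphere y₀ r ∩ Y) '' R) = 0 := by
  have hm0 : (0 : ℝ) < m := by exact_mod_cast hm
  set R' := toMeasurable volume R
  have hR' : volume R' = 0 := by rwa [measure_toMeasurable]
  set A : Set (E (m + 1)) := {y | dist y y₀ ∈ R'} with hA
  have hAm : MeasurableSet A :=
    (continuous_id.dist continuous_const).measurable (measurableSet_toMeasurable _ _)
  -- The value ∞ on a null union of spheres costs nothing in the volume integral, yet gives infinite
  -- integral over each section of positive area.
  let ρ : E (m + 1) → ℝ≥0∞ := A.indicator fun _ => ⊤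
  have hρ : Measurable ρ := measurable_const.indicator hAm
  refine le_antisymm ?_ zero_le
  have hadm : ρ ∈ adm ((fun r => Metric.sphere y₀ r ∩ Y) '' R) := by
    refine ⟨hρ, ?_⟩
    rintro _ ⟨r, hr, rfl⟩
    have hexp : ((m + 1 : ℕ) : ℝ) - 1 = m := by push_cast; ring
    have hle : ∫⁻ _ in Metric.sphere y₀ r ∩ Y, (⊤ : ℝ≥0∞) ∂(areaMeasure (m + 1)) ≤
        surfaceIntegral ρ (Metric.sphere y₀ r ∩ Y) := by
      rw [surfaceIntegral, hexp]
      have hS : Metric.sphere y₀ r ⊆ A := fun y hy => by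
        rw [hA, mem_ofPred_eq, Metric.mem_sphere.1 hy]
        exact subset_toMeasurable _ _ hr
      have hsub : (areaMeasure (m + 1)).restrict (Metric.sphere y₀ r ∩ Y) =
          ((areaMeasure (m + 1)).restrict (Metric.sphere y₀ r ∩ Y)).restrict A := by
        rw [Measure.restrict_restrict hAm, inter_eq_right.2 (inter_subset_left.trans hS)]
      rw [hsub]
      refine setLIntegral_mono' hAm fun y hy => ?_
      simp only [ρ, indicator_of_mem hy]
      rw [ENNReal.top_rpow_of_pos hm0]
    refine le_trans ?_ hle
    rw [lintegral_const, Measure.restrict_apply_univ, ENNReal.top_mul (hpos r hr)]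
    exact le_top
  refine (iInf₂_le ρ hadm).trans ?_
  have : ∫⁻ y, ρ y ^ p = ∫⁻ _ : E (m + 1), (0 : ℝ≥0∞) := by
    refine lintegral_congr_ae ?_
    have hnull := volume_preimage_dist_eq_zero y₀ hR'
    filter_upwards [compl_mem_ae_iff.2 hnull] with y hy
    simp only [ρ]
    rw [indicator_of_notMem hy, ENNReal.zero_rpow_of_pos hp]
  rw [this, lintegral_zero]

/-- Raising to the power m undoes the root, and the area bound of each piece returns the integral of
g over that piece of the preimage; the rest of the preimage has zero area. -/
theorem one_le_surfaceIntegral_of_regularPieces {m : ℕ} (hm : 0 < m)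
    {f : E (m + 1) → E (m + 1)} {D : Set (E (m + 1))} {κ : ℝ} {B : ℕ → Set (E (m + 1))}
    {c : ℕ → ℝ≥0∞} (h : ∀ k, IsRegularPiece f D κ (B k) (c k)) {g : E (m + 1) → ℝ≥0∞}
    (hg : Measurable g) (y₀ : E (m + 1)) {r : ℝ} (hr : 0 < r)
    (hnull : areaMeasure (m + 1) (D ∩ f ⁻¹' Metric.sphere y₀ r ∩ (D \ ⋃ k, B k)) = 0)
    (hadm : 1 ≤ ∫⁻ x in D ∩ f ⁻¹' (Metric.sphere y₀ r ∩ f '' D), g x ∂(areaMeasure (m + 1))) :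
    1 ≤ surfaceIntegral (fun y => (∑' k, c k * transport f (B k) g y) ^ (1 / (m : ℝ)))
      (Metric.sphere y₀ r ∩ f '' D) := by
  have hm0 : (m : ℝ) ≠ 0 := by exact_mod_cast hm.ne'
  have hexp : ((m + 1 : ℕ) : ℝ) - 1 = m := by push_cast; ring
  have hint : surfaceIntegral (fun y => (∑' k, c k * transport f (B k) g y) ^ (1 / (m : ℝ)))
      (Metric.sphere y₀ r ∩ f '' D) =
      ∑' k, c k * ∫⁻ y in Metric.sphere y₀ r ∩ f '' D, transport f (B k) g y
        ∂(areaMeasure (m + 1)) := by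
    rw [surfaceIntegral, hexp]
    have hmeas : ∀ k, Measurable (transport f (B k) g) := fun k =>
      measurable_transport (h k).measurableEmbedding hg
    simp_rw [← ENNReal.rpow_mul, one_div_mul_cancel hm0, ENNReal.rpow_one]
    rw [lintegral_tsum fun k => ((hmeas k).const_mul _).aemeasurable]
    exact tsum_congr fun k => lintegral_const_mul _ (hmeas k)
  rw [hint]
  refine hadm.trans ?_
  have hsub : D ∩ f ⁻¹' (Metric.sphere y₀ r ∩ f '' D) ⊆
      (D ∩ f ⁻¹' Metric.sphere y₀ r ∩ (D \ ⋃ k, B k)) ∪ ⋃ k, B k ∩ f ⁻¹' Metric.sphere y₀ r := by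
    rintro x ⟨hxD, hxS, -⟩
    by_cases hx : x ∈ ⋃ k, B k
    · right
      rw [← iUnion_inter]
      exact ⟨hx, hxS⟩
    · exact Or.inl ⟨⟨hxD, hxS⟩, hxD, hx⟩
  calc ∫⁻ x in D ∩ f ⁻¹' (Metric.sphere y₀ r ∩ f '' D), g x ∂(areaMeasure (m + 1))
      ≤ ∫⁻ x in (D ∩ f ⁻¹' Metric.sphere y₀ r ∩ (D \ ⋃ k, B k)) ∪
          ⋃ k, B k ∩ f ⁻¹' Metric.sphere y₀ r, g x ∂(areaMeasure (m + 1)) :=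
        lintegral_mono_set hsub
    _ ≤ ∫⁻ x in (D ∩ f ⁻¹' Metric.sphere y₀ r ∩ (D \ ⋃ k, B k)), g x ∂(areaMeasure (m + 1)) +
        ∫⁻ x in ⋃ k, B k ∩ f ⁻¹' Metric.sphere y₀ r, g x ∂(areaMeasure (m + 1)) :=
        lintegral_union_le _ _ _
    _ ≤ 0 + ∑' k, ∫⁻ x in B k ∩ f ⁻¹' Metric.sphere y₀ r, g x ∂(areaMeasure (m + 1)) := by
        refine add_le_add ?_ (lintegral_iUnion_le _ _)
        rw [setLIntegral_measure_zero _ _ hnull]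
    _ ≤ _ := by
        rw [zero_add]
        exact ENNReal.tsum_le_tsum fun k => (h k).lintegral_le y₀ hr hg

/-- The pointwise Hölder bound cancels the dilatation; the weight 1/|J| then cancels the Jacobian on
each piece, and disjointness sums the pieces. -/
theorem lintegral_div_inverseDilatation_le {m : ℕ} (hm : 0 < m) {f : E (m + 1) → E (m + 1)}
    {D : Set (E (m + 1))} {κ : ℝ} (hκ : 0 ≤ κ) {B : ℕ → Set (E (m + 1))} {c : ℕ → ℝ≥0∞}
    (h : ∀ k, IsRegularPiece f D κ (B k) (c k)) (hd : Pairwise (Function.onFun Disjoint B))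
    {p : ℝ} (hp : (m : ℝ) < p) {g : E (m + 1) → ℝ≥0∞} (hg : Measurable g) (S : Set (E (m + 1))) :
    ∫⁻ y in S, ((∑' k, c k * transport f (B k) g y) ^ (1 / (m : ℝ))) ^ p /
        inverseDilatation (p / (p - m)) f D y ^ ((p - m) / m) ≤
      ENNReal.ofReal κ ^ (p / m) * ∫⁻ x, g x ^ (p / m) := by
  set w : E (m + 1) → ℝ≥0∞ := fun x => g x ^ (p / m) / ENNReal.ofReal |jacobian f x| with hw
  have hwm : Measurable w :=
    (hg.pow_const _).div (measurable_jacobian f).abs.ennreal_ofReal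
  have hmeas : ∀ k, Measurable (transport f (B k) w) := fun k =>
    measurable_transport (h k).measurableEmbedding hwm
  calc ∫⁻ y in S, ((∑' k, c k * transport f (B k) g y) ^ (1 / (m : ℝ))) ^ p /
        inverseDilatation (p / (p - m)) f D y ^ ((p - m) / m)
      ≤ ∫⁻ y in S, ENNReal.ofReal κ ^ (p / m) * ∑' k, transport f (B k) w y := by
        refine lintegral_mono fun y => ENNReal.div_le_of_le_mul ?_
        rw [← ENNReal.rpow_mul, one_div_mul_eq_div]
        exact rpow_tsum_transport_le hm hκ h hd hp g y
    _ ≤ ∫⁻ y, ENNReal.ofReal κ ^ (p / m) * ∑' k, transport f (B k) w y :=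
        setLIntegral_le_lintegral _ _
    _ = ENNReal.ofReal κ ^ (p / m) * ∑' k, ∫⁻ x in B k, g x ^ (p / m) := by
        rw [lintegral_const_mul _ (Measurable.tsum hmeas),
          lintegral_tsum fun k => (hmeas k).aemeasurable]
        congr 1
        exact tsum_congr fun k => (h k).lintegral_transport_div_jacobian _
    _ ≤ _ := by
        gcongr
        rw [← lintegral_iUnion (fun k => (h k).measurableSet) hd]
        exact setLIntegral_le_lintegral _ _

theorem iInf_extAdm_le_modulusTilde {m : ℕ} (hm : 0 < m) {p : ℝ} (hp : (m : ℝ) < p)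
    {D : Set (E (m + 1))} (hD : IsOpen D) (hDconn : IsPreconnected D)
    {f : E (m + 1) → E (m + 1)} (hf : ContinuousOn f D)
    (hdiff : ∀ᵐ x ∂(volume.restrict D), DifferentiableAt ℝ f x)
    (hN : LuzinN f D) (hNinv : LuzinNInv f D) (hfin : ∀ y, {x | x ∈ D ∧ f x = y}.Finite)
    {y₀ : E (m + 1)} (hy₀ : y₀ ∈ closure (f '' D)) {ε : ℝ} (hε : 0 < ε)
    (hsph : ∀ᵐ r ∂(volume.restrict (radii ε (outerRadius f D y₀))),
      LuzinNInvOn f D (Metric.sphere y₀ r ∩ f '' D)) (S : Set (E (m + 1))) :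
    (⨅ ρ ∈ extAdm p (imageFamily f (preimageSpheres f D y₀ ε)),
        ∫⁻ y in S, ρ y ^ p / inverseDilatation (p / (p - m)) f D y ^ ((p - m) / m))
      ≤ modulusTilde (p / m) (preimageSpheres f D y₀ ε) := by
  have hm0 : (0 : ℝ) < m := by exact_mod_cast hm
  have hp0 : 0 < p := hm0.trans hp
  refine le_iInf₂ fun g hg => ?_
  obtain ⟨hgm, hgadm⟩ := hg
  have hkey : ∀ κ : ℝ, 1 < κ →
      (⨅ ρ ∈ extAdm p (imageFamily f (preimageSpheres f D y₀ ε)),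
        ∫⁻ y in S, ρ y ^ p / inverseDilatation (p / (p - m)) f D y ^ ((p - m) / m))
      ≤ ENNReal.ofReal (κ * κ) ^ (p / m) * ∫⁻ x, g x ^ (p / m) := by
    intro κ hκ
    obtain ⟨B, c, h, hd, hnull⟩ := exists_regularPieces (f := f) hD.measurableSet hκ
    have hZ : volume (D \ ⋃ k, B k) = 0 := by
      refine measure_mono_null ?_
        (measure_union_null (volume_diff_regularPoints hD.measurableSet hdiff hNinv) hnull)
      rintro x ⟨hxD, hxB⟩
      by_cases hx : x ∈ regularPoints f D
      · exact Or.inr ⟨hx, hxB⟩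
      · exact Or.inl ⟨hxD, hx⟩
    set ρ : E (m + 1) → ℝ≥0∞ :=
      fun y => (∑' k, c k * transport f (B k) g y) ^ (1 / (m : ℝ)) with hρ
    have hρm : Measurable ρ := (Measurable.tsum fun k =>
      (measurable_transport (h k).measurableEmbedding hgm).const_mul _).pow_const _
    have hgood : ∀ᵐ r, r ∈ radii ε (outerRadius f D y₀) →
        1 ≤ surfaceIntegral ρ (Metric.sphere y₀ r ∩ f '' D) := by
      rw [ae_restrict_iff' (measurableSet_radii _ _)] at hsph
      filter_upwards [hsph, ae_areaMeasure_inter_sphere_eq_zero hm y₀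
        (hN _ sdiff_subset hZ)] with r hr1 hr2 hr
      refine one_le_surfaceIntegral_of_regularPieces hm h hgm y₀ (hε.trans hr.1) ?_
        (hgadm _ ⟨r, hr, rfl⟩)
      -- Almost every sphere meets the null set f(Z), Z = D \ ⋃ B k, in zero area; the N⁻¹-property
      -- on that sphere pulls this back.
      have h3 := hr1 hr (f '' (D \ ⋃ k, B k) ∩ Metric.sphere y₀ r)
        (fun y hy => ⟨hy.2, image_mono sdiff_subset hy.1⟩) hr2
      refine measure_mono_null ?_ h3
      rintro x ⟨⟨hxD, hxS⟩, hxZ⟩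
      exact ⟨hxD, ⟨x, hxZ, rfl⟩, hxS⟩
    set R₀ : Set ℝ := {r | r ∈ radii ε (outerRadius f D y₀) ∧
      ¬ 1 ≤ surfaceIntegral ρ (Metric.sphere y₀ r ∩ f '' D)} with hR₀
    have hR₀null : volume R₀ = 0 := by
      rw [ae_iff] at hgood
      refine measure_mono_null ?_ hgood
      rintro r ⟨h1, h2⟩ h3
      exact h2 (h3 h1)
    have hρext : ρ ∈ extAdm p (imageFamily f (preimageSpheres f D y₀ ε)) := by
      refine ⟨hρm.nullMeasurable, (fun r => Metric.sphere y₀ r ∩ f '' D) '' R₀, ?_, ?_, ?_⟩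
      · rw [imageFamily_preimageSpheres]
        exact image_mono fun r hr => hr.1
      · refine modulus_spheres_eq_zero hm hp0 y₀ _ hR₀null fun r hr => ?_
        obtain ⟨h1, h2⟩ := exists_dist_lt_of_mem_radii hy₀ hε hr.1
        exact areaMeasure_sphere_inter_image_ne_zero hD hDconn hf hNinv hfin h1 h2
      · rintro T ⟨hT, hT0⟩
        rw [imageFamily_preimageSpheres] at hT
        obtain ⟨r, hr, rfl⟩ := hT
        by_contra hbad
        exact hT0 ⟨r, ⟨hr, hbad⟩, rfl⟩
    exact (iInf₂_le ρ hρext).trans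
      (lintegral_div_inverseDilatation_le hm (by positivity) h hd hp hgm S)
  -- The infimum does not involve κ, so the loss κ² disappears as κ decreases to 1.
  have hlim : Tendsto (fun κ : ℝ => ENNReal.ofReal (κ * κ) ^ (p / m) * ∫⁻ x, g x ^ (p / m))
      (𝓝[>] 1) (𝓝 (1 * ∫⁻ x, g x ^ (p / m))) := by
    refine ENNReal.Tendsto.mul_const ?_ (Or.inl one_ne_zero)
    have hc : Continuous fun κ : ℝ => ENNReal.ofReal (κ * κ) ^ (p / m) :=
      ENNReal.continuous_rpow_const.comp (ENNReal.continuous_ofReal.comp (by fun_prop))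
    have := (hc.tendsto 1).mono_left (nhdsWithin_le_nhds (s := Ioi 1))
    simpa using this
  rw [one_mul] at hlim
  refine ge_of_tendsto hlim ?_
  filter_upwards [self_mem_nhdsWithin] with κ hκ
  exact hkey κ hκ

end

theorem corollary1 (n : ℕ) (hn : 2 ≤ n) (p : ℝ) (hp : (n : ℝ) - 1 < p)
    (D : Set (EuclideanSpace ℝ (Fin n))) (hD : IsOpen D) (hDconn : IsConnected D)
    (f : EuclideanSpace ℝ (Fin n) → EuclideanSpace ℝ (Fin n)) (hf : ContinuousOn f D)
    (hdiff : ∀ᵐ x ∂(volume.restrict D), DifferentiableAt ℝ f x)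
    (hN : LuzinN f D) (hNinv : LuzinNInv f D)
    (y₀ : EuclideanSpace ℝ (Fin n)) (hy₀ : y₀ ∈ closure (f '' D))
    (ε : ℝ) (hε : 0 < ε)
    (hsph : ∀ᵐ r ∂(volume.restrict (radii ε (outerRadius f D y₀))),
      LuzinNInvOn f D (Metric.sphere y₀ r ∩ f '' D)) :
    1 / (maxMultiplicity f D : ℝ≥0∞) ^ (p / ((n : ℝ) - 1)) *
        (⨅ ρ ∈ extAdm p (imageFamily f (preimageSpheres f D y₀ ε)),
          ∫⁻ y in f '' D ∩ sphericalRing y₀ ε (outerRadius f D y₀),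
            ρ y ^ p /
              inverseDilatation (p / (p - (n : ℝ) + 1)) f D y ^
                ((p - (n : ℝ) + 1) / ((n : ℝ) - 1)))
      ≤ modulusTilde (p / ((n : ℝ) - 1)) (preimageSpheres f D y₀ ε) := by
  obtain ⟨m, rfl⟩ : ∃ m, n = m + 1 := ⟨n - 1, by omega⟩
  have hm : 0 < m := by omega
  have hm0 : (0 : ℝ) < m := by exact_mod_cast hm
  have e1 : ((m + 1 : ℕ) : ℝ) - 1 = m := by push_cast; ring
  have e2 : p - ((m + 1 : ℕ) : ℝ) + 1 = p - m := by push_cast; ring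
  rw [e1] at hp
  rw [e1, e2]
  have hq : 0 < p / (m : ℝ) := div_pos (hm0.trans hp) hm0
  -- With infinite multiplicity the left side is 0. Otherwise all fibres are finite and, D being
  -- nonempty, N(f, D) ≥ 1, so the factor can be dropped.
  by_cases htop : maxMultiplicity f D = ⊤
  · rw [htop, ENat.toENNReal_top, ENNReal.top_rpow_of_pos hq]
    simp
  · have hone : 1 ≤ (maxMultiplicity f D : ℝ≥0∞) := by
      obtain ⟨x, hx⟩ := hDconn.nonempty
      have h1 : (1 : ℕ∞) ≤ maxMultiplicity f D := by
        refine le_trans ?_ (le_iSup (fun y => multiplicityAt f D y) (f x))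
        rw [multiplicityAt, Set.one_le_encard_iff_nonempty]
        exact ⟨x, hx, rfl⟩
      exact_mod_cast h1
    refine le_trans (mul_le_of_le_one_left' ?_) (iInf_extAdm_le_modulusTilde hm hp hD
      hDconn.isPreconnected hf hdiff hN hNinv (finite_fibre_of_maxMultiplicity_ne_top htop) hy₀ hε
      hsph _)
    rw [one_div]
    exact ENNReal.inv_le_one.2 (ENNReal.one_le_rpow hone hq)
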